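/- Let $n$ be a positive integer. Parts of partitions are positive integers with a colour $a_ib_k$ ($i,k\ge 0$); the colour is free if $i=k$ and bound if $i\neq k$; $p_c$ denotes the part $p$ in colour $c$. Let $$\Delta(a_ib_k,a_{i'}b_{k'})=\chi(i\ge i')-\chi(i=k=i')+\chi(k\le k')-\chi(k=i'=k'),$$ where $\chi(P)$ is $1$ if $P$ holds and $0$ otherwise. Let $\mathcal P_n$ be the set of partitions $\lambda_1+\cdots+\lambda_s$ whose parts have colours in $\{a_ib_k:0\le i,k\le n-1\}$ and such that $\lambda_j-\lambda_{j+1}\ge\Delta(c(\lambda_j),c(\lambda_{j+1}))$ for $1\le j<s$, where $c(\lambda_j)$ is the colour of $\lambda_j$. Let $\delta$ be an integer-valued function on bound colours with $\min\{k,\ell\}<\delta(a_kb_\ell)\le\max\{k,\ell\}$ for all $k\ne\ell$ (Condition 1). Let $\gamma$ be an integer-valued function on pairs of bound colours such that, for all $k_1\neq\ell_1$ and $k_2\ne\ell_2$, with $\gamma=\gamma(a_{k_1}b_{\ell_1},a_{k_2}b_{\ell_2})$ (Condition 2): * if $\max\{k_1,\ell_2\}<\min\{k_2,\ell_1\}$,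 then $\max\{k_1,\ell_2\}<\gamma\le\min\{k_2,\ell_1\}$; * if $k_1>\ell_1$, $k_2>\ell_2$ and $D:=\{\ell_2+1,\dots,k_2\}\setminus\{\ell_1+1,\dots,k_1\}\ne\emptyset$, then $\gamma\in D$; * if $k_1<\ell_1$, $k_2<\ell_2$ and $U:=\{k_1+1,\dots,\ell_1\}\setminus\{k_2+1,\dots,\ell_2\}\neq\emptyset$, then $\gamma\in U$. Let $\mathcal C_n(\delta,\gamma)$, the set of generalised Capparelli partitions, be the set of $\lambda\in\mathcal P_n$ that have no part coloured $a_0b_0$ and that do not contain any of the following patterns as consecutive parts, for any positive integer $p$, where $c_1=a_{k_1}b_{\ell_1}$, $c_2=a_{k_2}b_{\ell_2}$: * $p_{a_ib_i}+p_{a_ib_i}$ with $1\le i\le n-1$; * $p_{c_1}+p_{a_ib_i}+p_{c_2}$ with $\max\{k_1,\ell_2\}<\min\{k_2,\ell_1\}$ and $i=\gamma(c_1,c_2)$; * if $k_2>\ell_2$: * $(p+u)_{c_1}+p_{a_ib_i}+p_{c_2}$ with $2\le u\le\infty$, $k_1,\ell_1$ arbitrary and $i=\delta(c_2)$ ($u=\infty$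 means that $p_{a_ib_i}+p_{c_2}$ is at the beginning of $\lambda$); * $(p+1)_{c_1}+p_{a_ib_i}+p_{c_2}$ with $k_1\le\ell_1$ and $i=\delta(c_2)$; * $(p+1)_{c_1}+p_{a_ib_i}+p_{c_2}$ with $k_1>\ell_1$, $D\ne\emptyset$ and $i=\gamma(c_1,c_2)$; * if $k_1<\ell_1$: * $p_{c_1}+p_{a_ib_i}+(p-u)_{c_2}$ with $2\le u\le\infty$, $k_2,\ell_2$ arbitrary and $i=\delta(c_1)$ ($u=\infty$ means that $p_{c_1}+p_{a_ib_i}$ is at the end of $\lambda$); * $(p+1)_{c_1}+(p+1)_{a_ib_i}+p_{c_2}$ with $k_2\ge\ell_2$ and $i=\delta(c_1)$; * $(p+1)_{c_1}+(p+1)_{a_ib_i}+p_{c_2}$ with $k_2<\ell_2$, $U\neq\emptyset$ and $i=\gamma(c_1,c_2)$. Let $C_n(\delta,\gamma;m;u_0,\dots,u_{n-1};v_0,\dots,v_{n-1})$ be the (finite) number of partitions of $m$ in $\mathcal C_n(\delta,\gamma)$ in whose colours the symbol $a_i$ appears $u_i$ times and the symbol $b_i$ appears $v_i$ times, for $0\le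 i\le n-1$. Write $(a;q)_\infty=\prod_{k\ge0}(1-aq^k)$. Then, as formal series in $q$, $$\sum_{m,u_0,\dots,u_{n-1},v_0,\dots,v_{n-1}\ge0}C_n(\delta,\gamma;m;u_0,\dots,u_{n-1};v_0,\dots,v_{n-1})\,q^{\,nm-\sum_{i=0}^{n-1}i(u_i-v_i)}=\frac{(q^n;q^n)_\infty}{(q;q)_\infty}.$$ In other words, for every integer $N\ge0$, the number of partitions in $\mathcal C_n(\delta,\gamma)$ whose parts sum to $N$ after the dilation $k_{a_ib_j}\mapsto nk-i+j$ is finite and equals the number of $n$-regular partitions of $N$, i.e. partitions of $N$ with no part divisible by $n$. -/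

import Mathlib

open scoped PowerSeries PowerSeries.WithPiTopology LaurentSeries

/-- The colour `a_k b_l`; it is free if `k = l` and bound if `k ≠ l`. -/
structure Colour where
  a : ℕ
  b : ℕ

namespace Colour

/-- `a_k b_l` is a bound colour. -/
def IsBound (c : Colour) : Prop := c.a ≠ c.b

/-- The minimal difference
`Δ(a_i b_k, a_i' b_k') = χ(i ≥ i') - χ(i = k = i') + χ(k ≤ k') - χ(k = i' = k')`. -/
def minDiff (c d : Colour) : ℤ :=
  (if c.a ≥ d.a then 1 else 0) - (if c.a = c.b ∧ c.b = d.a then 1 else 0)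
    + (if c.b ≤ d.b then 1 else 0) - (if c.b = d.a ∧ d.a = d.b then 1 else 0)

end Colour

/-- A coloured part `p_c`: the part `size = p` in the colour `c`. -/
structure ColouredPart where
  size : ℕ
  colour : Colour

/-- The generalised Primc partitions `𝒫_n`. The partition `λ_1 + ⋯ + λ_s` is the list
`[λ_1, …, λ_s]` (it is weakly decreasing in size, since `Δ ≥ 0`). -/
structure IsPrimc (n : ℕ) (L : List ColouredPart) : Prop where
  pos : ∀ x ∈ L, 0 < x.size
  colour_lt : ∀ x ∈ L, x.colour.a < n ∧ x.colour.b < n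
  diff : L.IsChain fun x y => Colour.minDiff x.colour y.colour ≤ (x.size : ℤ) - (y.size : ℤ)

/-- Condition 1 on `δ`. Only the values of `δ` on bound colours are constrained or ever used. -/
def Condition1 (δ : Colour → ℤ) : Prop :=
  ∀ c : Colour, c.IsBound → (min c.a c.b : ℤ) < δ c ∧ δ c ≤ (max c.a c.b : ℤ)

/-- The set difference `{u + 1, …, v} \ {u' + 1, …, v'}`. -/
def intervalDiff (u v u' v' : ℕ) : Set ℤ :=
  Set.Icc ((u : ℤ) + 1) (v : ℤ) \ Set.Icc ((u' : ℤ) + 1) (v' : ℤ)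

/-- Condition 2 on `γ`. Only the values of `γ` on pairs of bound colours are constrained or ever
used. -/
structure Condition2 (γ : Colour → Colour → ℤ) : Prop where
  up_down : ∀ k₁ l₁ k₂ l₂ : ℕ, k₁ ≠ l₁ → k₂ ≠ l₂ → max k₁ l₂ < min k₂ l₁ →
    (max k₁ l₂ : ℤ) < γ ⟨k₁, l₁⟩ ⟨k₂, l₂⟩ ∧ γ ⟨k₁, l₁⟩ ⟨k₂, l₂⟩ ≤ (min k₂ l₁ : ℤ)
  down_down : ∀ k₁ l₁ k₂ l₂ : ℕ, l₁ < k₁ → l₂ < k₂ → (intervalDiff l₂ k₂ l₁ k₁).Nonempty →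
    γ ⟨k₁, l₁⟩ ⟨k₂, l₂⟩ ∈ intervalDiff l₂ k₂ l₁ k₁
  up_up : ∀ k₁ l₁ k₂ l₂ : ℕ, k₁ < l₁ → k₂ < l₂ → (intervalDiff k₁ l₁ k₂ l₂).Nonempty →
    γ ⟨k₁, l₁⟩ ⟨k₂, l₂⟩ ∈ intervalDiff k₁ l₁ k₂ l₂

/-- The generalised Capparelli partitions `𝒞_n(δ, γ)`. Here `⟨p, k, l⟩` is the part `p` in the
colour `a_k b_l`, and `π <:+: L` says that `L` contains the pattern `π` at consecutive places;
`π <+: L` and `π <:+ L` say that it does so at the beginning and at the end of `L`. -/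
structure IsCapparelli (n : ℕ) (δ : Colour → ℤ) (γ : Colour → Colour → ℤ)
    (L : List ColouredPart) : Prop where
  primc : IsPrimc n L
  /-- no part is coloured `a_0 b_0` -/
  no_zero : ∀ x ∈ L, x.colour ≠ ⟨0, 0⟩
  /-- free colours cannot repeat -/
  no_repeat : ∀ p i : ℕ, 0 < p → 1 ≤ i → i < n → ¬ [⟨p, i, i⟩, ⟨p, i, i⟩] <:+: L
  avoid_mid : ∀ p k₁ l₁ k₂ l₂ i : ℕ, 0 < p → max k₁ l₂ < min k₂ l₁ →
    (i : ℤ) = γ ⟨k₁, l₁⟩ ⟨k₂, l₂⟩ → ¬ [⟨p, k₁, l₁⟩, ⟨p, i, i⟩, ⟨p, k₂, l₂⟩] <:+: L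
  /-- `k₂ > l₂`, the case of a finite `u ≥ 2` -/
  avoid_left_far : ∀ p u k₁ l₁ k₂ l₂ i : ℕ, 0 < p → l₂ < k₂ → 2 ≤ u →
    (i : ℤ) = δ ⟨k₂, l₂⟩ → ¬ [⟨p + u, k₁, l₁⟩, ⟨p, i, i⟩, ⟨p, k₂, l₂⟩] <:+: L
  /-- `k₂ > l₂`, the case `u = ∞` -/
  avoid_left_start : ∀ p k₂ l₂ i : ℕ, 0 < p → l₂ < k₂ →
    (i : ℤ) = δ ⟨k₂, l₂⟩ → ¬ [⟨p, i, i⟩, ⟨p, k₂, l₂⟩] <+: L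
  avoid_left_up : ∀ p k₁ l₁ k₂ l₂ i : ℕ, 0 < p → l₂ < k₂ → k₁ ≤ l₁ →
    (i : ℤ) = δ ⟨k₂, l₂⟩ → ¬ [⟨p + 1, k₁, l₁⟩, ⟨p, i, i⟩, ⟨p, k₂, l₂⟩] <:+: L
  avoid_left_down : ∀ p k₁ l₁ k₂ l₂ i : ℕ, 0 < p → l₂ < k₂ → l₁ < k₁ →
    (intervalDiff l₂ k₂ l₁ k₁).Nonempty → (i : ℤ) = γ ⟨k₁, l₁⟩ ⟨k₂, l₂⟩ →
    ¬ [⟨p + 1, k₁, l₁⟩, ⟨p, i, i⟩, ⟨p, k₂, l₂⟩] <:+: L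
  /-- `k₁ < l₁`, the case of a finite `u ≥ 2`; here `p` is the smallest of the three parts -/
  avoid_right_far : ∀ p u k₁ l₁ k₂ l₂ i : ℕ, 0 < p → k₁ < l₁ → 2 ≤ u →
    (i : ℤ) = δ ⟨k₁, l₁⟩ → ¬ [⟨p + u, k₁, l₁⟩, ⟨p + u, i, i⟩, ⟨p, k₂, l₂⟩] <:+: L
  /-- `k₁ < l₁`, the case `u = ∞` -/
  avoid_right_end : ∀ p k₁ l₁ i : ℕ, 0 < p → k₁ < l₁ →
    (i : ℤ) = δ ⟨k₁, l₁⟩ → ¬ [⟨p, k₁, l₁⟩, ⟨p, i, i⟩] <:+ L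
  avoid_right_down : ∀ p k₁ l₁ k₂ l₂ i : ℕ, 0 < p → k₁ < l₁ → l₂ ≤ k₂ →
    (i : ℤ) = δ ⟨k₁, l₁⟩ → ¬ [⟨p + 1, k₁, l₁⟩, ⟨p + 1, i, i⟩, ⟨p, k₂, l₂⟩] <:+: L
  avoid_right_up : ∀ p k₁ l₁ k₂ l₂ i : ℕ, 0 < p → k₁ < l₁ → k₂ < l₂ →
    (intervalDiff k₁ l₁ k₂ l₂).Nonempty → (i : ℤ) = γ ⟨k₁, l₁⟩ ⟨k₂, l₂⟩ →
    ¬ [⟨p + 1, k₁, l₁⟩, ⟨p + 1, i, i⟩, ⟨p, k₂, l₂⟩] <:+: L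

/-- The partitions of `m` in `𝒞_n(δ, γ)` in which the symbol `a_i` (resp. `b_i`) appears
`u i` (resp. `v i`) times in the colours, for each `i ∈ {0, …, n - 1}`. -/
def capparelliSet (n : ℕ) (δ : Colour → ℤ) (γ : Colour → Colour → ℤ)
    (m : ℕ) (u v : Fin n → ℕ) : Set (List ColouredPart) :=
  {L | IsCapparelli n δ γ L ∧ (L.map ColouredPart.size).sum = m ∧
    (∀ i : Fin n, L.countP (fun x => x.colour.a = (i : ℕ)) = u i) ∧
    (∀ i : Fin n, L.countP (fun x => x.colour.b = (i : ℕ)) = v i)}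

/-- The number `C_n(δ, γ; m; u_0, …, u_{n-1}; v_0, …, v_{n-1})`. -/
noncomputable def capparelliCount (n : ℕ) (δ : Colour → ℤ) (γ : Colour → Colour → ℤ)
    (m : ℕ) (u v : Fin n → ℕ) : ℕ :=
  (capparelliSet n δ γ m u v).ncard

/-- The weight after the dilation `k_{a_i b_j} ↦ n k - i + j` of the parts. -/
def dilatedWeight (n : ℕ) (L : List ColouredPart) : ℤ :=
  (L.map fun x => (n : ℤ) * x.size - x.colour.a + x.colour.b).sum

/-- `(a; q)_∞ = ∏_{k ≥ 0} (1 - a q^k)` as a formal power series. -/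
noncomputable def qPochhammerInf (a q : ℚ⟦X⟧) : ℚ⟦X⟧ :=
  ∏' k : ℕ, (1 - a * q ^ k)

/-- The infinite product `(q^m; q^m)_∞` converges. -/
theorem multipliable_qPochhammerInf (m : ℕ) (hm : 0 < m) :
    Multipliable fun k : ℕ =>
      (1 : ℚ⟦X⟧) - (PowerSeries.X : ℚ⟦X⟧) ^ m * ((PowerSeries.X : ℚ⟦X⟧) ^ m) ^ k := by
  simp_rw [sub_eq_add_neg]
  apply PowerSeries.WithPiTopology.multipliable_one_add_of_tendsto_order_atTop_nhds_top
  refine ENat.tendsto_nhds_top_iff_natCast_lt.mpr fun N => ?_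
  filter_upwards [Filter.eventually_gt_atTop N] with k hk
  rw [PowerSeries.order_neg, ← pow_mul, ← pow_add, PowerSeries.order_X_pow]
  have : k ≤ m * k := Nat.le_mul_of_pos_left k hm
  exact_mod_cast (by omega : N < m + m * k)

/-! Write `P_n` and `C_n` for the generating functions, by dilated weight, of the generalised Primc
and Capparelli partitions. In this weight a free part of size `r` weighs `n r`, whatever its colour.

Removal of free parts: `P_n = C_n / (q^n; q^n)_∞` (`genSeries_primc_eq_mul`). In a Primc partition
all free parts of one size have the same colour. For every size `r`, the bound parts alone single
out one free colour, `forbidden`, and Conditions 1 and 2 guarantee that a part of size `r` in this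
colour can be inserted (`forbIndex_spec`, `forbidden_spec`). Taken together, the excluded patterns
say that no part is repeated and no free part has the forbidden colour (`isCapparelli_iff`). So a
Primc partition amounts to a Capparelli partition and an arbitrary multiset of sizes: each `r` in
the multiset adds a copy of the free part of size `r` already present or, if there is none, a free
part of the forbidden colour.

Independence of `n`: `P_n = P_1` (`genSeries_primc_eq`). Building partitions from the smallest part
upwards gives a linear recursion over the `n^2` colours. Its solution is explicit
(`toLaurent_chainSeries`), because the terms of the recursion are second differences of a
quasi-periodic function and the sum over the colours telescopes twice (`chainValue_succ`). With `Q =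
q^n`, partitions with at most `M` parts have generating function `∑_s q^(s^2) / (q; q)_s^2 * (Q;
Q)_M / (Q; Q)_{M-s}`. Modulo `q^(M+1)` the last quotient can be replaced by `1`, and `n` disappears.

The case `n = 1`: the only colour is the excluded `a_0 b_0`, so `C_1 = 1` and the factorisation
gives `P_1 = 1 / (q; q)_∞`. Hence `C_n = (q^n; q^n)_∞ / (q; q)_∞`. The refined counts only regroup
the partitions by a statistic that determines their weight. -/

/-- All fibres over natural numbers of the weight `w` on `S` are finite. -/
def FiniteFibres {α : Type*} (S : Set α) (w : α → ℤ) : Prop :=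
  ∀ e : ℕ, {x ∈ S | w x = e}.Finite

/-- The generating function of the elements of `S` by the weight `w`. -/
noncomputable def genSeries {α : Type*} (S : Set α) (w : α → ℤ) : ℚ⟦X⟧ :=
  PowerSeries.mk fun e : ℕ => ({x ∈ S | w x = e}.ncard : ℚ)

/-! ### Generating functions of weighted sets. -/

section GenSeries

variable {α β ι : Type*}

theorem coeff_genSeries (S : Set α) (w : α → ℤ) (e : ℕ) :
    PowerSeries.coeff e (genSeries S w) = ({x ∈ S | w x = e}.ncard : ℚ) :=
  PowerSeries.coeff_mk _ _

theorem FiniteFibres.mono {S T : Set α} {w : α → ℤ} (hT : FiniteFibres T w) (h : S ⊆ T) :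
    FiniteFibres S w :=
  fun e => (hT e).subset fun _ hx => ⟨h hx.1, hx.2⟩

theorem genSeries_union {S T : Set α} {w : α → ℤ} (h : Disjoint S T)
    (hS : FiniteFibres S w) (hT : FiniteFibres T w) :
    genSeries (S ∪ T) w = genSeries S w + genSeries T w := by
  ext e
  rw [map_add, coeff_genSeries, coeff_genSeries, coeff_genSeries, ← Nat.cast_add,
    ← Set.ncard_union_eq _ (hS e) (hT e)]
  · congr 2
    ext x
    simp only [Set.mem_union, Set.mem_ofPred_eq]
    tauto
  · exact Set.disjoint_left.2 fun x hx hy => Set.disjoint_left.1 h hx.1 hy.1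

theorem genSeries_empty (w : α → ℤ) : genSeries (∅ : Set α) w = 0 := by
  ext e
  simp [coeff_genSeries]

theorem genSeries_biUnion (I : Finset ι) (S : ι → Set α) (w : α → ℤ)
    (h : ∀ i ∈ I, ∀ j ∈ I, i ≠ j → Disjoint (S i) (S j)) (hS : ∀ i ∈ I, FiniteFibres (S i) w) :
    genSeries (⋃ i ∈ I, S i) w = ∑ i ∈ I, genSeries (S i) w := by
  classical
  induction I using Finset.induction_on with
  | empty => simp [genSeries_empty]
  | insert a I ha ih =>
    rw [Finset.sum_insert ha, Finset.set_biUnion_insert, genSeries_union, ih]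
    · exact fun i hi j hj => h i (Finset.mem_insert_of_mem hi) j (Finset.mem_insert_of_mem hj)
    · exact fun i hi => hS i (Finset.mem_insert_of_mem hi)
    · simp only [Set.disjoint_iUnion_right]
      intro i hi
      exact h a (Finset.mem_insert_self _ _) i (Finset.mem_insert_of_mem hi)
        (fun hai => ha (hai ▸ hi))
    · exact hS a (Finset.mem_insert_self _ _)
    · intro e
      refine ((I.finite_toSet).biUnion
        (fun i hi => hS i (Finset.mem_insert_of_mem hi) e)).subset ?_
      rintro x ⟨hx, hxe⟩
      simp only [Set.mem_iUnion] at hx ⊢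
      obtain ⟨i, hi, hx⟩ := hx
      exact ⟨i, hi, hx, hxe⟩

/-- The sign condition on `v` matters: fibres over negative integers are not counted, and a shift by
`k` could bring them into view. -/
theorem genSeries_bijOn {S : Set α} {T : Set β} {v : α → ℤ} {w : β → ℤ} (f : α → β) (k : ℕ)
    (hf : Set.BijOn f S T) (hw : ∀ x ∈ S, w (f x) = v x + k) (hv : ∀ x ∈ S, 0 ≤ v x) :
    genSeries T w = PowerSeries.X ^ k * genSeries S v := by
  ext e
  rw [PowerSeries.coeff_X_pow_mul', coeff_genSeries]
  split_ifs with hk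
  · rw [coeff_genSeries]
    congr 1
    have : {x ∈ T | w x = e} = f '' {x ∈ S | v x = (e - k : ℕ)} := by
      ext y
      simp only [Set.mem_ofPred_eq, Set.mem_image]
      constructor
      · rintro ⟨hy, hye⟩
        obtain ⟨x, hx, rfl⟩ := hf.surjOn hy
        refine ⟨x, ⟨hx, ?_⟩, rfl⟩
        have := hw x hx
        push_cast [hk]
        omega
      · rintro ⟨x, ⟨hx, hxe⟩, rfl⟩
        refine ⟨hf.mapsTo hx, ?_⟩
        rw [hw x hx, hxe]
        push_cast [hk]
        omega
    rw [this, Set.InjOn.ncard_image (hf.injOn.mono fun x hx => hx.1)]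
  · have : {x ∈ T | w x = e} = ∅ := by
      rw [Set.eq_empty_iff_forall_notMem]
      rintro y ⟨hy, hye⟩
      obtain ⟨x, hx, rfl⟩ := hf.surjOn hy
      have := hw x hx
      have := hv x hx
      omega
    simp [this]

theorem genSeries_prod {S : Set α} {T : Set β} {v : α → ℤ} {w : β → ℤ}
    (hv : ∀ x ∈ S, 0 ≤ v x) (hw : ∀ x ∈ T, 0 ≤ w x) (hS : FiniteFibres S v)
    (hT : FiniteFibres T w) :
    genSeries (S ×ˢ T) (fun x => v x.1 + w x.2) = genSeries S v * genSeries T w := by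
  ext e
  rw [PowerSeries.coeff_mul, coeff_genSeries]
  have : {x ∈ S ×ˢ T | v x.1 + w x.2 = e} = ⋃ i ∈ Finset.HasAntidiagonal.antidiagonal e,
      {x ∈ S | v x = (i.1 : ℕ)} ×ˢ {x ∈ T | w x = (i.2 : ℕ)} := by
    ext ⟨x, y⟩
    simp only [Set.mem_ofPred_eq, Set.mem_prod, Set.mem_iUnion, Finset.HasAntidiagonal.mem_antidiagonal,
      Prod.exists, exists_prop]
    constructor
    · rintro ⟨⟨hx, hy⟩, he⟩
      have := hv x hx
      have := hw y hy
      exact ⟨(v x).toNat, (w y).toNat, by omega, ⟨hx, by omega⟩, hy, by omega⟩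
    · rintro ⟨i, j, hij, ⟨hx, hi⟩, hy, hj⟩
      exact ⟨⟨hx, hy⟩, by omega⟩
  rw [this]
  have hcard : ∀ I : Finset (ℕ × ℕ), ((⋃ i ∈ I,
      {x ∈ S | v x = (i.1 : ℕ)} ×ˢ {x ∈ T | w x = (i.2 : ℕ)}).Finite ∧ (⋃ i ∈ I,
      {x ∈ S | v x = (i.1 : ℕ)} ×ˢ {x ∈ T | w x = (i.2 : ℕ)}).ncard = ∑ i ∈ I,
      {x ∈ S | v x = (i.1 : ℕ)}.ncard * {x ∈ T | w x = (i.2 : ℕ)}.ncard) := by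
    classical
    intro I
    induction I using Finset.induction_on with
    | empty => simp
    | insert a I ha ih =>
      rw [Finset.sum_insert ha, Finset.set_biUnion_insert, ← ih.2, ← Set.ncard_prod]
      refine ⟨((hS _).prod (hT _)).union ih.1, Set.ncard_union_eq ?_ ((hS _).prod (hT _)) ih.1⟩
      simp only [Set.disjoint_iUnion_right]
      intro i hi
      rw [Set.disjoint_left]
      rintro ⟨x, y⟩ ⟨hx, hy⟩ ⟨hx', hy'⟩
      apply ha
      have h₁ : a.1 = i.1 := by have := hx.2; have := hx'.2; simp only at *; omega
      have h₂ : a.2 = i.2 := by have := hy.2; have := hy'.2; simp only at *; omega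
      rwa [Prod.ext h₁ h₂]
  rw [(hcard _).2]
  push_cast
  exact Finset.sum_congr rfl fun i _ => by rw [coeff_genSeries, coeff_genSeries]

end GenSeries

/-! ### Admissible parts and the dilated weight. -/

/-- The parts `x` and `y` may be neighbours, in this order, in a generalised Primc partition. -/
def PrimcRel (x y : ColouredPart) : Prop :=
  Colour.minDiff x.colour y.colour ≤ (x.size : ℤ) - (y.size : ℤ)

/-- The part is positive and its colour is one of the `n ^ 2` available ones. -/
def Admissible (n : ℕ) (x : ColouredPart) : Prop :=
  0 < x.size ∧ x.colour.a < n ∧ x.colour.b < n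

theorem Colour.minDiff_nonneg (c d : Colour) : 0 ≤ Colour.minDiff c d := by
  unfold Colour.minDiff
  split_ifs <;> omega

theorem ColouredPart.ext' {x y : ColouredPart} (h : x.size = y.size)
    (ha : x.colour.a = y.colour.a) (hb : x.colour.b = y.colour.b) : x = y := by
  rcases x with ⟨p, a, b⟩
  rcases y with ⟨p', a', b'⟩
  simp_all

theorem isPrimc_iff {n : ℕ} {L : List ColouredPart} :
    IsPrimc n L ↔ (∀ x ∈ L, Admissible n x) ∧ L.IsChain PrimcRel :=
  ⟨fun h => ⟨fun x hx => ⟨h.pos x hx, h.colour_lt x hx⟩, h.diff⟩,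
    fun h => ⟨fun x hx => (h.1 x hx).1, fun x hx => (h.1 x hx).2, h.2⟩⟩

section Weight

theorem dilatedWeight_nil (n : ℕ) : dilatedWeight n [] = 0 := rfl

theorem dilatedWeight_cons (n : ℕ) (x : ColouredPart) (L : List ColouredPart) :
    dilatedWeight n (x :: L) =
      ((n : ℤ) * x.size - x.colour.a + x.colour.b) + dilatedWeight n L := by
  simp [dilatedWeight]

theorem dilatedWeight_perm (n : ℕ) {L M : List ColouredPart} (h : L.Perm M) :
    dilatedWeight n L = dilatedWeight n M :=
  (h.map _).sum_eq

theorem Admissible.weight_pos {n : ℕ} {x : ColouredPart} (h : Admissible n x) :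
    0 < (n : ℤ) * x.size - x.colour.a + x.colour.b := by
  obtain ⟨h₁, h₂, _⟩ := h
  have : (n : ℤ) * 1 ≤ n * x.size := by
    exact_mod_cast Nat.mul_le_mul_left n h₁
  omega

theorem Admissible.size_le {n : ℕ} {x : ColouredPart} (h : Admissible n x) :
    (x.size : ℤ) ≤ (n : ℤ) * x.size - x.colour.a + x.colour.b := by
  obtain ⟨h₁, h₂, _⟩ := h
  nlinarith

theorem length_le_dilatedWeight {n : ℕ} {L : List ColouredPart} (h : ∀ x ∈ L, Admissible n x) :
    (L.length : ℤ) ≤ dilatedWeight n L := by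
  induction L with
  | nil => simp [dilatedWeight_nil]
  | cons x L ih =>
    have h₁ := (h x (List.mem_cons_self)).weight_pos
    have h₂ := ih fun y hy => h y (List.mem_cons_of_mem _ hy)
    rw [dilatedWeight_cons]
    push_cast [List.length_cons]
    omega

theorem dilatedWeight_nonneg {n : ℕ} {L : List ColouredPart} (h : ∀ x ∈ L, Admissible n x) :
    0 ≤ dilatedWeight n L :=
  le_trans (by positivity) (length_le_dilatedWeight h)

theorem size_le_dilatedWeight {n : ℕ} {L : List ColouredPart} (h : ∀ x ∈ L, Admissible n x)
    {x : ColouredPart} (hx : x ∈ L) : (x.size : ℤ) ≤ dilatedWeight n L := by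
  induction L with
  | nil => simp at hx
  | cons y L ih =>
    have h₂ : ∀ x ∈ L, Admissible n x := fun z hz => h z (List.mem_cons_of_mem _ hz)
    have h₃ := dilatedWeight_nonneg h₂
    have h₄ := h y (List.mem_cons_self)
    rw [dilatedWeight_cons]
    rcases List.mem_cons.1 hx with rfl | hx
    · have := h₄.size_le
      omega
    · have := h₄.weight_pos
      have := ih h₂ hx
      omega

theorem genSeries_nil (n : ℕ) :
    genSeries ({[]} : Set (List ColouredPart)) (dilatedWeight n) = 1 := by
  ext e
  rw [coeff_genSeries, PowerSeries.coeff_one]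
  split_ifs with he
  · subst he
    rw [show {x ∈ ({[]} : Set (List ColouredPart)) | dilatedWeight n x = (0 : ℕ)} = {[]} by
      ext; simp only [Set.mem_ofPred_eq, Set.mem_singleton_iff, and_iff_left_iff_imp]
      rintro rfl; simp [dilatedWeight_nil]]
    simp
  · rw [show {x ∈ ({[]} : Set (List ColouredPart)) | dilatedWeight n x = e} = ∅ by
      ext; simp only [Set.mem_ofPred_eq, Set.mem_singleton_iff, Set.mem_empty_iff_false, iff_false]
      rintro ⟨rfl, h⟩; simp [dilatedWeight_nil] at h; omega]
    simp

theorem finite_admissible_lists (n m l : ℕ) :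
    {L : List ColouredPart | (∀ x ∈ L, Admissible n x ∧ x.size ≤ m) ∧ L.length ≤ l}.Finite := by
  have hfin : {x : ColouredPart | Admissible n x ∧ x.size ≤ m}.Finite := by
    refine (Set.finite_range (fun t : Fin (m + 1) × Fin n × Fin n =>
      (⟨t.1, t.2.1, t.2.2⟩ : ColouredPart))).subset ?_
    rintro ⟨p, a, b⟩ ⟨⟨_, ha, hb⟩, hp⟩
    exact ⟨(⟨p, Nat.lt_succ_of_le hp⟩, ⟨a, ha⟩, ⟨b, hb⟩), rfl⟩
  have : Finite {x : ColouredPart // Admissible n x ∧ x.size ≤ m} := hfin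
  refine ((List.finite_length_le {x : ColouredPart // Admissible n x ∧ x.size ≤ m} l).image
    (List.map Subtype.val)).subset ?_
  rintro L ⟨h, hl⟩
  refine ⟨L.attach.map fun x => ⟨x.1, h x.1 x.2⟩, ?_, ?_⟩
  · simpa using hl
  · simp [Function.comp_def]

/-- The weight of an admissible part is at least its size and at least `1`, so the total weight
bounds both the sizes and the number of parts. -/
theorem finiteFibres_of_admissible {n : ℕ} {S : Set (List ColouredPart)}
    (h : ∀ L ∈ S, ∀ x ∈ L, Admissible n x) : FiniteFibres S (dilatedWeight n) := by
  intro e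
  refine (finite_admissible_lists n e e).subset ?_
  rintro L ⟨hL, he⟩
  have h₁ := h L hL
  refine ⟨fun x hx => ⟨h₁ x hx, ?_⟩, ?_⟩
  · have := size_le_dilatedWeight h₁ hx
    omega
  · have := length_le_dilatedWeight h₁
    omega

end Weight

/-! ### Recursion for Primc partitions, built from the smallest part upwards. -/

section Chains

/-- Lists of `N` parts, read from the smallest part on, that may be put on top of the part `y`. -/
def chainsAbove (n N : ℕ) (y : ColouredPart) : Set (List ColouredPart) :=
  {M | M.length = N ∧ (∀ x ∈ M, x.colour.a < n ∧ x.colour.b < n) ∧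
    (y :: M).IsChain fun u v => PrimcRel v u}

/-- Lists of `N + 1` parts, read from the smallest part on, the smallest part being of
colour `d` and of size at least `t`. -/
def chainsFrom (n N : ℕ) (d : Colour) (t : ℕ) : Set (List ColouredPart) :=
  {M | ∃ x M', M = x :: M' ∧ x.colour = d ∧ t ≤ x.size ∧ M' ∈ chainsAbove n N x}

/-- Add `1` to the size of every part. -/
def shiftParts (M : List ColouredPart) : List ColouredPart :=
  M.map fun x => ⟨x.size + 1, x.colour⟩

theorem PrimcRel.size_le {x y : ColouredPart} (h : PrimcRel x y) : y.size ≤ x.size := by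
  have := Colour.minDiff_nonneg x.colour y.colour
  unfold PrimcRel at h
  omega

theorem mem_chainsAbove_succ {n N : ℕ} {y : ColouredPart} {M : List ColouredPart} :
    M ∈ chainsAbove n (N + 1) y ↔ ∃ x M', M = x :: M' ∧ (x.colour.a < n ∧ x.colour.b < n) ∧
      PrimcRel x y ∧ M' ∈ chainsAbove n N x := by
  cases M with
  | nil => simp [chainsAbove]
  | cons x M =>
    simp only [chainsAbove, Set.mem_ofPred_eq, List.length_cons, List.isChain_cons_cons,
      List.mem_cons, forall_eq_or_imp, List.cons.injEq]
    constructor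
    · rintro ⟨h₁, ⟨h₂, h₃⟩, h₄, h₅⟩
      exact ⟨x, M, ⟨rfl, rfl⟩, h₂, h₄, by omega, h₃, h₅⟩
    · rintro ⟨x', M', ⟨rfl, rfl⟩, h₂, h₄, h₁, h₃, h₅⟩
      exact ⟨by omega, ⟨h₂, h₃⟩, h₄, h₅⟩

theorem chainsAbove_zero (n : ℕ) (y : ColouredPart) : chainsAbove n 0 y = {[]} := by
  ext M
  simp only [chainsAbove, Set.mem_ofPred_eq, Set.mem_singleton_iff, List.length_eq_zero_iff]
  constructor
  · exact fun h => h.1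
  · rintro rfl
    simp

theorem size_le_of_mem_chainsAbove {n N : ℕ} {y : ColouredPart} {M : List ColouredPart}
    (h : M ∈ chainsAbove n N y) : ∀ x ∈ M, y.size ≤ x.size := by
  induction N generalizing y M with
  | zero => rw [chainsAbove_zero] at h; simp_all
  | succ N ih =>
    obtain ⟨x, M', rfl, _, hxy, hM⟩ := mem_chainsAbove_succ.1 h
    intro z hz
    rcases List.mem_cons.1 hz with rfl | hz
    · exact hxy.size_le
    · exact hxy.size_le.trans (ih hM z hz)

theorem admissible_of_mem_chainsAbove {n N : ℕ} {y : ColouredPart} (hy : 0 < y.size) :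
    ∀ M ∈ chainsAbove n N y, ∀ x ∈ M, Admissible n x :=
  fun _ hM x hx => ⟨hy.trans_le (size_le_of_mem_chainsAbove hM x hx), hM.2.1 x hx⟩

theorem admissible_of_mem_chainsFrom {n N t : ℕ} {d : Colour} (ht : 0 < t)
    (hd : d.a < n ∧ d.b < n) : ∀ M ∈ chainsFrom n N d t, ∀ x ∈ M, Admissible n x := by
  rintro _ ⟨x, M, rfl, rfl, hx, hM⟩ z hz
  rcases List.mem_cons.1 hz with rfl | hz
  · exact ⟨ht.trans_le hx, hd⟩
  · exact admissible_of_mem_chainsAbove (ht.trans_le hx) M hM z hz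

theorem shiftParts_injective : Function.Injective shiftParts := by
  refine List.map_injective_iff.2 ?_
  rintro ⟨p, c⟩ ⟨p', c'⟩ h
  simp_all

theorem dilatedWeight_shiftParts (n : ℕ) (M : List ColouredPart) :
    dilatedWeight n (shiftParts M) = dilatedWeight n M + ((n * M.length : ℕ) : ℤ) := by
  induction M with
  | nil => simp [shiftParts, dilatedWeight_nil]
  | cons x M ih =>
    rw [shiftParts, List.map_cons, ← shiftParts, dilatedWeight_cons, ih, dilatedWeight_cons]
    push_cast [List.length_cons]
    ring

theorem primcRel_shift (x y : ColouredPart) :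
    PrimcRel ⟨x.size + 1, x.colour⟩ ⟨y.size + 1, y.colour⟩ ↔ PrimcRel x y := by
  simp only [PrimcRel]
  push_cast
  constructor <;> intro h <;> linarith

theorem bijOn_shiftParts_chainsAbove (n N t : ℕ) (c : Colour) :
    Set.BijOn shiftParts (chainsAbove n N ⟨t, c⟩) (chainsAbove n N ⟨t + 1, c⟩) := by
  refine ⟨?_, shiftParts_injective.injOn, ?_⟩
  · induction N generalizing t c with
    | zero => simp [chainsAbove_zero, Set.MapsTo, shiftParts]
    | succ N ih =>
      intro M hM
      obtain ⟨⟨p, d⟩, M', rfl, h₁, h₂, h₃⟩ := mem_chainsAbove_succ.1 hM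
      exact mem_chainsAbove_succ.2 ⟨⟨p + 1, d⟩, shiftParts M', rfl, h₁,
        (primcRel_shift ⟨p, d⟩ ⟨t, c⟩).2 h₂, ih p d h₃⟩
  · induction N generalizing t c with
    | zero =>
      simp [chainsAbove_zero, Set.SurjOn, shiftParts]
    | succ N ih =>
      intro M hM
      obtain ⟨⟨p, d⟩, M', rfl, h₁, h₂, h₃⟩ := mem_chainsAbove_succ.1 hM
      have hp : t + 1 ≤ p := h₂.size_le
      obtain ⟨p, rfl⟩ : ∃ p', p = p' + 1 := ⟨p - 1, by omega⟩
      obtain ⟨M'', hM'', rfl⟩ := ih p d h₃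
      exact ⟨⟨p, d⟩ :: M'', mem_chainsAbove_succ.2 ⟨_, _, rfl, h₁,
        (primcRel_shift ⟨p, d⟩ ⟨t, c⟩).1 h₂, hM''⟩, rfl⟩

theorem bijOn_shiftParts_chainsFrom (n N t : ℕ) (d : Colour) :
    Set.BijOn shiftParts (chainsFrom n N d t) (chainsFrom n N d (t + 1)) := by
  refine ⟨?_, shiftParts_injective.injOn, ?_⟩
  · rintro _ ⟨⟨p, d⟩, M, rfl, rfl, h₁, h₂⟩
    exact ⟨⟨p + 1, d⟩, shiftParts M, rfl, rfl, Nat.succ_le_succ h₁,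
      (bijOn_shiftParts_chainsAbove n N p d).mapsTo h₂⟩
  · rintro _ ⟨⟨p, d⟩, M, rfl, rfl, h₁, h₂⟩
    simp only at h₁
    obtain ⟨p, rfl⟩ : ∃ p', p = p' + 1 := ⟨p - 1, by omega⟩
    obtain ⟨M', hM', rfl⟩ := (bijOn_shiftParts_chainsAbove n N p d).surjOn h₂
    exact ⟨⟨p, d⟩ :: M', ⟨_, _, rfl, rfl, Nat.succ_le_succ_iff.1 h₁, hM'⟩, rfl⟩

/-- The generating function of the chains of `N` parts above the part `1` in the colour `c`. -/
noncomputable def chainSeries (n N : ℕ) (c : Colour) : ℚ⟦X⟧ :=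
  genSeries (chainsAbove n N ⟨1, c⟩) (dilatedWeight n)

/-- The generating function of the chains of `N + 1` positive parts with smallest part of
colour `d`. -/
noncomputable def fromSeries (n N : ℕ) (d : Colour) : ℚ⟦X⟧ :=
  genSeries (chainsFrom n N d 1) (dilatedWeight n)

theorem genSeries_chainsFrom (n N t : ℕ) (d : Colour) (hd : d.a < n ∧ d.b < n) :
    genSeries (chainsFrom n N d (1 + t)) (dilatedWeight n) =
      PowerSeries.X ^ (n * (N + 1) * t) * fromSeries n N d := by
  induction t with
  | zero => simp [fromSeries]
  | succ t ih =>
    rw [← add_assoc, genSeries_bijOn shiftParts (n * (N + 1))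
      (bijOn_shiftParts_chainsFrom n N (1 + t) d), ih, ← mul_assoc, ← pow_add]
    · congr 2
      ring
    · rintro _ ⟨x, M, rfl, _, _, hM⟩
      rw [dilatedWeight_shiftParts, List.length_cons, hM.1]
    · exact fun M hM => dilatedWeight_nonneg (admissible_of_mem_chainsFrom (by omega) hd M hM)

/-- Either the smallest part is `1_d`, of weight `n - d.a + d.b`, or all `N + 1` parts can be
lowered by one, which takes away `n * (N + 1)`. -/
theorem fromSeries_eq (n N : ℕ) (d : Colour) (hd : d.a < n ∧ d.b < n) :
    (1 - PowerSeries.X ^ (n * (N + 1))) * fromSeries n N d =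
      PowerSeries.X ^ (n - d.a + d.b) * chainSeries n N d := by
  have h : chainsFrom n N d 1 =
      (List.cons ⟨1, d⟩ '' chainsAbove n N ⟨1, d⟩) ∪ chainsFrom n N d (1 + 1) := by
    ext M
    simp only [chainsFrom, Set.mem_union, Set.mem_image, Set.mem_ofPred_eq]
    constructor
    · rintro ⟨⟨p, d⟩, M', rfl, rfl, h₁, h₂⟩
      rcases Nat.lt_or_ge 1 p with hp | hp
      · exact Or.inr ⟨_, _, rfl, rfl, hp, h₂⟩
      · have : p = 1 := le_antisymm hp h₁
        subst this
        exact Or.inl ⟨_, h₂, rfl⟩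
    · rintro (⟨M', h₂, rfl⟩ | ⟨x, M', rfl, h₁, h₂, h₃⟩)
      · exact ⟨_, _, rfl, rfl, le_rfl, h₂⟩
      · exact ⟨_, _, rfl, h₁, by omega, h₃⟩
  have hadm : ∀ M ∈ chainsFrom n N d 1, ∀ x ∈ M, Admissible n x :=
    admissible_of_mem_chainsFrom one_pos hd
  have hfin := finiteFibres_of_admissible hadm
  have e : fromSeries n N d = PowerSeries.X ^ (n - d.a + d.b) * chainSeries n N d +
      PowerSeries.X ^ (n * (N + 1) * 1) * fromSeries n N d := by
    rw [← genSeries_chainsFrom n N 1 d hd, chainSeries,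
      ← genSeries_bijOn (List.cons ⟨1, d⟩) (n - d.a + d.b)
        (T := List.cons ⟨1, d⟩ '' chainsAbove n N ⟨1, d⟩) (w := dilatedWeight n),
      ← genSeries_union, ← h, fromSeries]
    · rw [Set.disjoint_left]
      rintro _ ⟨M, _, rfl⟩ ⟨x, M', hM, _, h₁, _⟩
      obtain ⟨rfl, -⟩ := List.cons.inj hM
      simp at h₁
    · exact hfin.mono (h ▸ Set.subset_union_left)
    · exact hfin.mono (h ▸ Set.subset_union_right)
    · exact ⟨Set.mapsTo_image _ _, List.cons_injective.injOn, Set.surjOn_image _ _⟩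
    · intro M _
      rw [dilatedWeight_cons]
      push_cast [hd.1.le]
      ring
    · exact fun M hM => dilatedWeight_nonneg
        (admissible_of_mem_chainsAbove (by simp) M hM)
  rw [mul_one] at e
  linear_combination e

/-- The `n ^ 2` colours. -/
def colours (n : ℕ) : Finset (ℕ × ℕ) := Finset.range n ×ˢ Finset.range n

theorem mem_colours {n : ℕ} {d : ℕ × ℕ} : d ∈ colours n ↔ d.1 < n ∧ d.2 < n := by
  simp [colours]

theorem disjoint_chainsFrom {n N s t : ℕ} {c d : Colour} (h : c ≠ d) :
    Disjoint (chainsFrom n N c s) (chainsFrom n N d t) := by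
  rw [Set.disjoint_left]
  rintro _ ⟨x, M, rfl, rfl, _, _⟩ ⟨x', M', hM, rfl, _, _⟩
  obtain ⟨rfl, -⟩ := List.cons.inj hM
  exact h rfl

/-- A part of colour `d` directly above `1_c` has size at least `1 + Δ(d, c)`. Lowering the `N + 1`
parts by `Δ(d, c)` leaves an arbitrary chain of positive parts starting in `d`. -/
theorem chainSeries_succ (n N : ℕ) (c : Colour) :
    chainSeries n (N + 1) c = ∑ d ∈ colours n, PowerSeries.X ^
      (n * (N + 1) * (Colour.minDiff ⟨d.1, d.2⟩ c).toNat) * fromSeries n N ⟨d.1, d.2⟩ := by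
  have h : chainsAbove n (N + 1) ⟨1, c⟩ = ⋃ d ∈ colours n,
      chainsFrom n N ⟨d.1, d.2⟩ (1 + (Colour.minDiff ⟨d.1, d.2⟩ c).toNat) := by
    ext M
    simp only [mem_chainsAbove_succ, Set.mem_iUnion, chainsFrom, Set.mem_ofPred_eq, exists_prop,
      mem_colours, PrimcRel]
    constructor
    · rintro ⟨⟨p, a, b⟩, M', rfl, h₁, h₂, h₃⟩
      exact ⟨(a, b), h₁, ⟨p, a, b⟩, M', rfl, rfl, by
        have := Colour.minDiff_nonneg ⟨a, b⟩ c
        push_cast at h₂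
        simp only
        omega, h₃⟩
    · rintro ⟨⟨a, b⟩, h₁, ⟨p, a', b'⟩, M', rfl, h₂, h₃, h₄⟩
      cases h₂
      refine ⟨⟨p, a, b⟩, M', rfl, h₁, ?_, h₄⟩
      simp only at h₃
      push_cast
      omega
  rw [chainSeries, h, genSeries_biUnion]
  · refine Finset.sum_congr rfl fun d hd => ?_
    rw [genSeries_chainsFrom _ _ _ _ (mem_colours.1 hd)]
  · intro d _ d' _ hdd
    refine disjoint_chainsFrom fun h => hdd ?_
    simpa [Prod.ext_iff] using h
  · exact fun d hd => finiteFibres_of_admissible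
      (admissible_of_mem_chainsFrom (by omega) (mem_colours.1 hd))

/-- The generalised Primc partitions with `N` parts. -/
def primcOfLength (n N : ℕ) : Set (List ColouredPart) :=
  {L | IsPrimc n L ∧ L.length = N}

theorem genSeries_primcOfLength_zero (n : ℕ) :
    genSeries (primcOfLength n 0) (dilatedWeight n) = 1 := by
  have : primcOfLength n 0 = {[]} := by
    ext L
    simp only [primcOfLength, Set.mem_ofPred_eq, List.length_eq_zero_iff, Set.mem_singleton_iff]
    constructor
    · exact fun h => h.2
    · rintro rfl
      exact ⟨isPrimc_iff.2 ⟨by simp, List.isChain_nil⟩, rfl⟩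
  rw [this, genSeries_nil]

theorem genSeries_primcOfLength_succ (n N : ℕ) :
    genSeries (primcOfLength n (N + 1)) (dilatedWeight n) =
      ∑ d ∈ colours n, fromSeries n N ⟨d.1, d.2⟩ := by
  simp only [fromSeries]
  rw [← genSeries_biUnion]
  · rw [genSeries_bijOn List.reverse 0 (S := ⋃ d ∈ colours n, chainsFrom n N ⟨d.1, d.2⟩ 1)
      (v := dilatedWeight n), pow_zero, one_mul]
    · refine ⟨?_, List.reverse_injective.injOn, ?_⟩
      · intro M hM
        simp only [Set.mem_iUnion, exists_prop] at hM
        obtain ⟨d, hd, hM⟩ := hM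
        have hadm := admissible_of_mem_chainsFrom one_pos (mem_colours.1 hd) M hM
        obtain ⟨x, M, rfl, hx, hx', hM⟩ := hM
        refine ⟨isPrimc_iff.2 ⟨fun y hy => hadm y (List.mem_reverse.1 hy), ?_⟩, by simp [hM.1]⟩
        exact List.isChain_reverse.2 hM.2.2
      · rintro L ⟨hL, hlen⟩
        refine ⟨L.reverse, ?_, List.reverse_reverse _⟩
        obtain ⟨hL, hc⟩ := isPrimc_iff.1 hL
        rw [← List.reverse_reverse L, List.isChain_reverse] at hc
        have hL' : ∀ x ∈ L.reverse, Admissible n x := by simpa using hL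
        have hlen' : L.reverse.length = N + 1 := by simpa using hlen
        cases hr : L.reverse with
        | nil => simp [hr] at hlen'
        | cons x M =>
          rw [hr] at hc hL' hlen'
          have hx := hL' x List.mem_cons_self
          simp only [Set.mem_iUnion, exists_prop]
          refine ⟨(x.colour.a, x.colour.b), mem_colours.2 hx.2, x, M, rfl, rfl, hx.1, ?_⟩
          exact ⟨by simpa using hlen', fun y hy => (hL' y (List.mem_cons_of_mem _ hy)).2, hc⟩
    · intro M _
      rw [dilatedWeight_perm n M.reverse_perm]
      simp
    · intro M hM
      simp only [Set.mem_iUnion, exists_prop] at hM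
      obtain ⟨d, hd, hM⟩ := hM
      exact dilatedWeight_nonneg (admissible_of_mem_chainsFrom one_pos (mem_colours.1 hd) M hM)
  · intro d _ d' _ hdd
    refine disjoint_chainsFrom fun h => hdd ?_
    simpa [Prod.ext_iff] using h
  · exact fun d hd => finiteFibres_of_admissible
      (admissible_of_mem_chainsFrom one_pos (mem_colours.1 hd))

end Chains

/-! ### Closed solution of the recursion, over a field. -/

section Algebra

/-- The finite product `(x; x)_N`. -/
def qFactorial {A : Type*} [CommRing A] (x : A) (N : ℕ) : A :=
  ∏ j ∈ Finset.range N, (1 - x ^ (j + 1))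

theorem qFactorial_zero {A : Type*} [CommRing A] (x : A) : qFactorial x 0 = 1 := by
  simp [qFactorial]

theorem qFactorial_succ {A : Type*} [CommRing A] (x : A) (N : ℕ) :
    qFactorial x (N + 1) = qFactorial x N * (1 - x ^ (N + 1)) :=
  Finset.prod_range_succ _ _

variable {K : Type*} [Field K]

theorem qFactorial_ne_zero {x : K} (hx : ∀ m : ℕ, 0 < m → x ^ m ≠ 1) (N : ℕ) :
    qFactorial x N ≠ 0 :=
  Finset.prod_ne_zero_iff.2 fun j _ => sub_ne_zero.2 (hx (j + 1) j.succ_pos).symm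

/-- The generating function of Frobenius symbols with `s` columns, with a shift by `h`. -/
def frobTerm (q : K) (s : ℕ) (h : ℤ) : K :=
  q ^ ((s : ℤ) * (s + 1) + s * h) / qFactorial q s ^ 2

theorem frobTerm_zero (q : K) (h : ℤ) : frobTerm q 0 h = 1 := by
  simp [frobTerm, qFactorial_zero]

/-- A unit step in `h` multiplies the term by `q ^ (s + 1)`, so the second difference multiplies it
by `(1 - q ^ (s + 1)) ^ 2`. This cancels the last factors of the squared denominator. -/
theorem frobTerm_succ {q : K} (hq₀ : q ≠ 0) (hq : ∀ m : ℕ, 0 < m → q ^ m ≠ 1) (s : ℕ) (h : ℤ) :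
    frobTerm q (s + 1) h - 2 * frobTerm q (s + 1) (h + 1) + frobTerm q (s + 1) (h + 2) =
      q ^ (h + 2) * frobTerm q s (h + 2) := by
  have h₁ : ∀ j : ℕ, frobTerm q (s + 1) (h + j) = frobTerm q (s + 1) h * (q ^ (s + 1)) ^ j := by
    intro j
    simp only [frobTerm]
    rw [div_mul_eq_mul_div, ← pow_mul, ← zpow_natCast q ((s + 1) * j), ← zpow_add₀ hq₀]
    congr 2
    push_cast
    ring
  have h₂ := h₁ 1
  have h₃ := h₁ 2
  push_cast at h₂ h₃
  rw [h₂, h₃]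
  have h₄ : frobTerm q (s + 1) h * (1 - q ^ (s + 1)) ^ 2 = q ^ (h + 2) * frobTerm q s (h + 2) := by
    have hs := qFactorial_ne_zero hq s
    have hs' : (1 - q ^ (s + 1)) ≠ 0 := sub_ne_zero.2 (hq (s + 1) s.succ_pos).symm
    simp only [frobTerm]
    rw [qFactorial_succ, ← mul_div_assoc, ← zpow_add₀ hq₀,
      show (((s + 1 : ℕ) : ℤ) * ((s + 1 : ℕ) + 1) + (s + 1 : ℕ) * h) =
        h + 2 + ((s : ℤ) * (s + 1) + s * (h + 2)) by push_cast; ring]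
    field_simp
  rw [← h₄]
  ring

/-- The sum `∑ F_s(h) / (Q; Q)_{N - s}`. -/
def lowerSum (q Q : K) (N : ℕ) (h : ℤ) : K :=
  ∑ s ∈ Finset.range (N + 1), frobTerm q s h / qFactorial Q (N - s)

/-- The sum `∑ F_s(h) Q ^ (N - s) / (Q; Q)_{N - s}`. -/
def upperSum (q Q : K) (N : ℕ) (h : ℤ) : K :=
  ∑ s ∈ Finset.range (N + 1), frobTerm q s h * Q ^ (N - s) / qFactorial Q (N - s)

theorem lowerSum_zero (q Q : K) (h : ℤ) : lowerSum q Q 0 h = 1 := by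
  simp [lowerSum, frobTerm_zero, qFactorial_zero]

theorem upperSum_zero (q Q : K) (h : ℤ) : upperSum q Q 0 h = 1 := by
  simp [upperSum, frobTerm_zero, qFactorial_zero]

variable {q Q : K}

/-- The summand `s = 0` does not depend on `h` and drops out; `frobTerm_succ` lowers the index of
the others. -/
theorem lowerSum_diff (hq₀ : q ≠ 0) (hq : ∀ m : ℕ, 0 < m → q ^ m ≠ 1) (N : ℕ) (h : ℤ) :
    lowerSum q Q (N + 1) h - 2 * lowerSum q Q (N + 1) (h + 1) + lowerSum q Q (N + 1) (h + 2) =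
      q ^ (h + 2) * lowerSum q Q N (h + 2) := by
  simp only [lowerSum]
  rw [Finset.mul_sum, Finset.mul_sum, ← Finset.sum_sub_distrib, ← Finset.sum_add_distrib,
    Finset.sum_range_succ']
  simp only [frobTerm_zero, Nat.add_sub_add_right]
  rw [show ∀ x : K, 1 / x - 2 * (1 / x) + 1 / x = 0 by intro x; ring, add_zero]
  refine Finset.sum_congr rfl fun s _ => ?_
  rw [← mul_div_assoc, ← mul_div_assoc, ← frobTerm_succ hq₀ hq]
  ring

theorem upperSum_diff (hq₀ : q ≠ 0) (hq : ∀ m : ℕ, 0 < m → q ^ m ≠ 1) (N : ℕ) (h : ℤ) :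
    upperSum q Q (N + 1) h - 2 * upperSum q Q (N + 1) (h + 1) + upperSum q Q (N + 1) (h + 2) =
      q ^ (h + 2) * upperSum q Q N (h + 2) := by
  simp only [upperSum]
  rw [Finset.mul_sum, Finset.mul_sum, ← Finset.sum_sub_distrib, ← Finset.sum_add_distrib,
    Finset.sum_range_succ']
  simp only [frobTerm_zero, Nat.add_sub_add_right]
  rw [show ∀ x y : K, 1 * y / x - 2 * (1 * y / x) + 1 * y / x = 0 by intro x y; ring, add_zero]
  refine Finset.sum_congr rfl fun s _ => ?_
  rw [← mul_div_assoc, ← mul_div_assoc, ← mul_assoc (q ^ (h + 2)), ← frobTerm_succ hq₀ hq]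
  ring

/-- Termwise this is `Q^k / (Q; Q)_k = 1 / (Q; Q)_k - 1 / (Q; Q)_{k-1}`. -/
theorem upperSum_eq (hQ : ∀ m : ℕ, 0 < m → Q ^ m ≠ 1) (N : ℕ) (h : ℤ) :
    upperSum q Q (N + 1) h = lowerSum q Q (N + 1) h - lowerSum q Q N h := by
  simp only [upperSum, lowerSum]
  rw [Finset.sum_range_succ _ (N + 1), Finset.sum_range_succ _ (N + 1), add_sub_right_comm,
    ← Finset.sum_sub_distrib]
  simp only [Nat.sub_self, pow_zero, mul_one]
  congr 1
  refine Finset.sum_congr rfl fun s hs => ?_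
  have hs' : N + 1 - s = N - s + 1 := by
    have := Finset.mem_range.1 hs
    omega
  have h₁ := qFactorial_ne_zero hQ (N - s)
  have h₂ : (1 - Q ^ (N - s + 1)) ≠ 0 := sub_ne_zero.2 (hQ _ (Nat.succ_pos _)).symm
  rw [hs', qFactorial_succ]
  field_simp
  ring

/-- The shift by `n` multiplies the `s`-th term by `Q ^ s`, which completes `Q ^ (N - s)` to `Q ^
N`. Thus the two sums are adjacent pieces of one quasi-periodic function. -/
theorem upperSum_add (hq₀ : q ≠ 0) {n : ℕ} (hQ : Q = q ^ n) (N : ℕ) (h : ℤ) :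
    upperSum q Q N (h + n) = Q ^ N * lowerSum q Q N h := by
  simp only [upperSum, lowerSum]
  rw [Finset.mul_sum]
  refine Finset.sum_congr rfl fun s hs => ?_
  have hs' : s ≤ N := Nat.lt_succ_iff.1 (Finset.mem_range.1 hs)
  have h₁ : frobTerm q s (h + n) = frobTerm q s h * Q ^ s := by
    simp only [frobTerm]
    rw [div_mul_eq_mul_div, hQ, ← pow_mul, ← zpow_natCast q (n * s), ← zpow_add₀ hq₀]
    congr 2
    push_cast
    ring
  rw [h₁, mul_assoc, ← pow_add, Nat.add_sub_cancel' hs']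
  ring

/-- The common value, up to a factor, of the generating functions of chains above a colour. -/
def chainValue (q Q : K) (N : ℕ) (h : ℤ) : K :=
  if h < 0 then lowerSum q Q N h else upperSum q Q N h

/-- A function which is quasi-periodic in `m`, with multiplier `Q ^ N` for the period `n`, and
whose second differences are the terms of the recursion for `chainValue`. -/
def quasiPeriodic (q Q : K) (n N : ℕ) (C : K) (m : ℤ) : K :=
  (Q ^ N) ^ (m / n) * (upperSum q Q N (m % n) - C)

theorem quasiPeriodic_add (hQ₀ : Q ≠ 0) {n : ℕ} (hn : 0 < n) (N : ℕ) (C : K) (m : ℤ) :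
    quasiPeriodic q Q n N C (m + n) = Q ^ N * quasiPeriodic q Q n N C m := by
  have hn' : (n : ℤ) ≠ 0 := by exact_mod_cast hn.ne'
  rw [quasiPeriodic, quasiPeriodic, Int.add_ediv_of_dvd_right (dvd_refl _), Int.ediv_self hn',
    Int.add_emod_right, zpow_add₀ (pow_ne_zero _ hQ₀), zpow_one]
  ring

theorem quasiPeriodic_of_nonneg {n N : ℕ} {C : K} {m : ℤ} (h₀ : 0 ≤ m) (h₁ : m < n) :
    quasiPeriodic q Q n N C m = upperSum q Q N m - C := by
  rw [quasiPeriodic, Int.ediv_eq_zero_of_lt h₀ h₁, Int.emod_eq_of_lt h₀ h₁, zpow_zero, one_mul]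

theorem quasiPeriodic_of_neg (hq₀ : q ≠ 0) {n : ℕ} (hQ : Q = q ^ n) {N : ℕ} {C : K} {m : ℤ}
    (h₀ : -n ≤ m) (h₁ : m < 0) :
    quasiPeriodic q Q n N C m = lowerSum q Q N m - C / Q ^ N := by
  have hQ₀ : Q ≠ 0 := hQ ▸ pow_ne_zero _ hq₀
  have hn : 0 < n := by omega
  have h₂ := quasiPeriodic_add (q := q) hQ₀ hn N C m
  rw [quasiPeriodic_of_nonneg (by omega) (by omega), upperSum_add hq₀ hQ] at h₂
  have := pow_ne_zero N hQ₀
  field_simp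
  linear_combination -h₂

/-- The number `l - k` for the colour `a_k b_l` if it is bound, and `-1` if it is free. -/
def colourShift (d : ℕ × ℕ) : ℤ :=
  if d.1 = d.2 then -1 else (d.2 : ℤ) - d.1

/-- Inside a period this is `upperSum_diff` or `lowerSum_diff`, as second differences kill
constants. At the junction `0` the constant jumps by `C / Q ^ (N + 1) - C`, which `hC` makes equal
to `lowerSum q Q N (-1)`. In the difference ending in `1` the jump cancels the correction from
`upperSum_eq`. In the one ending in `0` it puts the value of `lowerSum` at `-1` in place of that at
`0`, which is why free colours get the shift `-1`. -/
theorem quasiPeriodic_diff (hq₀ : q ≠ 0) (hq : ∀ m : ℕ, 0 < m → q ^ m ≠ 1) {n : ℕ} (hn : 2 ≤ n)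
    (hQ : Q = q ^ n) (N : ℕ) {C : K}
    (hC : C * (1 - Q ^ (N + 1)) = Q ^ (N + 1) * lowerSum q Q N (-1)) {d : ℕ × ℕ}
    (hd : d ∈ colours n) :
    quasiPeriodic q Q n (N + 1) C ((d.2 : ℤ) - d.1 - 2) -
      2 * quasiPeriodic q Q n (N + 1) C ((d.2 : ℤ) - d.1 - 1) +
      quasiPeriodic q Q n (N + 1) C ((d.2 : ℤ) - d.1) =
      q ^ ((d.2 : ℤ) - d.1) * chainValue q Q N (colourShift d) := by
  obtain ⟨h₁, h₂⟩ := mem_colours.1 hd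
  have hQ₀ : Q ≠ 0 := hQ ▸ pow_ne_zero _ hq₀
  have hW := pow_ne_zero (N + 1) hQ₀
  have hQ' : ∀ m : ℕ, 0 < m → Q ^ m ≠ 1 := fun m hm => by
    rw [hQ, ← pow_mul]
    exact hq _ (by positivity)
  have hC' : C / Q ^ (N + 1) = C + lowerSum q Q N (-1) := by
    field_simp
    linear_combination hC
  -- the second difference that ends in `1`
  have one : quasiPeriodic q Q n (N + 1) C (-1) - 2 * quasiPeriodic q Q n (N + 1) C 0 +
      quasiPeriodic q Q n (N + 1) C 1 = q * upperSum q Q N 1 := by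
    rw [quasiPeriodic_of_neg hq₀ hQ (by omega) (by omega),
      quasiPeriodic_of_nonneg le_rfl (by omega), quasiPeriodic_of_nonneg (by omega) (by omega), hC']
    have e₁ := upperSum_diff (Q := Q) hq₀ hq N (-1)
    have e₂ := upperSum_eq (q := q) hQ' N (-1)
    norm_num at e₁
    linear_combination e₁ - e₂
  rcases eq_or_ne d.1 d.2 with he | he
  · -- the second difference that ends in `0`
    rw [colourShift, if_pos he, he, sub_self, chainValue, if_pos (by norm_num), zpow_zero, one_mul,
      quasiPeriodic_of_neg hq₀ hQ (by omega) (by omega),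
      quasiPeriodic_of_neg hq₀ hQ (by omega) (by omega),
      quasiPeriodic_of_nonneg le_rfl (by omega), hC']
    have e₁ := lowerSum_diff (Q := Q) hq₀ hq N (-2)
    have e₂ := upperSum_eq (q := q) hQ' N 0
    norm_num at e₁ ⊢
    linear_combination e₁ + e₂
  rw [colourShift, if_neg he]
  obtain ⟨m, hm⟩ : ∃ m : ℤ, m = (d.2 : ℤ) - d.1 := ⟨_, rfl⟩
  rw [← hm, chainValue]
  have hm₀ : m ≠ 0 := by omega
  rcases lt_or_ge m 0 with hm₁ | hm₁
  · rw [if_pos hm₁]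
    rcases lt_or_ge m (2 - n) with hm₂ | hm₂
    -- Here the three points straddle the junction `-n`; they are one period below those of the
    -- difference ending in `1`.
    · have hmn : m = 1 - n := by omega
      have per : ∀ j : ℤ, quasiPeriodic q Q n (N + 1) C j =
          Q ^ (N + 1) * quasiPeriodic q Q n (N + 1) C (j - n) := by
        intro j
        rw [← quasiPeriodic_add hQ₀ (by omega), sub_add_cancel]
      rw [per (-1), per 0, per 1, show (1 : ℤ) = 1 - n + n by ring, upperSum_add hq₀ hQ] at one
      have e₃ : q ^ (1 - (n : ℤ)) * Q = q := by
        rw [hQ, ← zpow_natCast, ← zpow_add₀ hq₀]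
        norm_num
      rw [hmn, show (1 - (n : ℤ)) - 2 = -1 - n by ring, show (1 - (n : ℤ)) - 1 = 0 - n by ring]
      apply mul_left_cancel₀ hW
      rw [show (1 : ℤ) - n + n - n = 1 - n by ring, show -(1 - (n : ℤ) + n) - n = -1 - n by ring]
        at one
      rw [pow_succ] at one ⊢
      linear_combination one + Q ^ N * lowerSum q Q N (1 - n) * (-e₃)
    · rw [quasiPeriodic_of_neg hq₀ hQ (by omega) (by omega),
        quasiPeriodic_of_neg hq₀ hQ (by omega) (by omega),
        quasiPeriodic_of_neg hq₀ hQ (by omega) (by omega)]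
      have e₁ := lowerSum_diff (Q := Q) hq₀ hq N (m - 2)
      rw [sub_add_cancel, show m - 2 + 1 = m - 1 by ring] at e₁
      linear_combination e₁
  · rw [if_neg (by omega)]
    rcases lt_or_ge m 2 with hm₂ | hm₂
    · have : m = 1 := by omega
      subst this
      norm_num
      exact one
    · rw [quasiPeriodic_of_nonneg (by omega) (by omega),
        quasiPeriodic_of_nonneg (by omega) (by omega),
        quasiPeriodic_of_nonneg (by omega) (by omega)]
      have e₁ := upperSum_diff (Q := Q) hq₀ hq N (m - 2)
      rw [sub_add_cancel, show m - 2 + 1 = m - 1 by ring] at e₁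
      linear_combination e₁

/-- The sum collapses to `W * (g (-1) - g κ) + (g κ - g (n - 1))`, and the outer terms cancel
because `g (n - 1) = W * g (-1)`. -/
theorem sum_telescope_le {n : ℕ} {W : K} {g : ℤ → K} (hg : ∀ y, g (y + n) = W * g y) {κ : ℤ}
    (h₀ : -1 ≤ κ) (h₁ : κ < n) :
    ∑ k ∈ Finset.range n, (if (k : ℤ) ≤ κ then W else 1) * (g (k - 1) - g k) =
      (1 - W) * g κ := by
  have key : ∀ m : ℕ, ∑ k ∈ Finset.range m, (if (k : ℤ) ≤ κ then W else 1) * (g (k - 1) - g k) =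
      if (m : ℤ) ≤ κ + 1 then W * (g (-1) - g (m - 1)) else
        W * (g (-1) - g κ) + (g κ - g (m - 1)) := by
    intro m
    induction m with
    | zero => simp [show (0 : ℤ) ≤ κ + 1 by omega]
    | succ m ih =>
      rw [Finset.sum_range_succ, ih]
      push_cast
      rw [add_sub_cancel_right]
      rcases lt_trichotomy (m : ℤ) (κ + 1) with h | h | h
      · rw [if_pos h.le, if_pos (by omega), if_pos (by omega)]
        ring
      · rw [if_pos h.le, if_neg (by omega), if_neg (by omega), h, add_sub_cancel_right]
        ring
      · rw [if_neg (by omega), if_neg (by omega), if_neg (by omega)]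
        ring
  have h₂ := hg (-1)
  rw [show (-1 : ℤ) + n = n - 1 by ring] at h₂
  rw [key]
  split_ifs with h
  · have : κ = n - 1 := by omega
    rw [this, h₂]
    ring
  · rw [h₂]
    ring

theorem sum_telescope_ge {n : ℕ} {W : K} {g : ℤ → K} (hg : ∀ y, g (y + n) = W * g y) {i : ℕ}
    (hi : i < n) (k : ℤ) :
    ∑ j ∈ Finset.range n, (if i ≤ j then W else 1) * (g (k - j - 1) - g (k - j)) =
      (1 - W) * g (k - i) := by
  have key : ∀ m : ℕ, ∑ j ∈ Finset.range m, (if i ≤ j then W else 1) *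
      (g (k - j - 1) - g (k - j)) =
      if m ≤ i then g (k - m) - g k else g (k - i) - g k + W * (g (k - m) - g (k - i)) := by
    intro m
    induction m with
    | zero => simp
    | succ m ih =>
      rw [Finset.sum_range_succ, ih]
      push_cast
      rw [← sub_sub]
      rcases lt_trichotomy m i with h | h | h
      · rw [if_pos h.le, if_neg (by omega), if_pos (by omega)]
        ring
      · subst h
        rw [if_pos le_rfl, if_pos le_rfl, if_neg (by omega)]
      · rw [if_neg (by omega), if_pos (by omega), if_neg (by omega)]
        ring
  have h₂ := hg (k - n)
  rw [sub_add_cancel] at h₂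
  rw [key, if_neg (by omega)]
  linear_combination -h₂

/-- Up to one exceptional colour, `W ^ Δ` splits into a factor in `d.1` and a factor in `d.2`, which
makes the double sum iterated. If `c` is free, the last term of `Δ` turns the condition `d.2 ≤ c.1`
into `d.2 ≤ c.1 - 1`; this is again the shift `-1`. -/
theorem pow_minDiff (W : K) (c d : ℕ × ℕ) :
    W ^ (Colour.minDiff ⟨d.1, d.2⟩ ⟨c.1, c.2⟩).toNat =
      (if c.1 ≤ d.1 then W else 1) * (if (d.2 : ℤ) ≤ c.1 + colourShift c then W else 1) +
        if d = (c.1, c.1) then (1 - W) * (if c.1 < c.2 then W else 1) else 0 := by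
  obtain ⟨i, k⟩ := c
  obtain ⟨i', k'⟩ := d
  simp only [Colour.minDiff, colourShift, Prod.mk.injEq, ge_iff_le]
  have two : (2 : ℤ).toNat = 2 := rfl
  split_ifs <;> first | omega | (norm_num [two] <;> ring)

/-- Each summand is a weight times a second difference of `V = quasiPeriodic q Q n (N + 1) C`.
Telescoping in both indices gives `(1 - W) ^ 2 * V (colourShift c)`, and the exceptional colour of
`pow_minDiff` restores the constant by which `V` differs from `chainValue`. -/
theorem chainValue_succ (hq₀ : q ≠ 0) (hq : ∀ m : ℕ, 0 < m → q ^ m ≠ 1) {n : ℕ} (hn : 2 ≤ n)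
    (hQ : Q = q ^ n) (N : ℕ) {c : ℕ × ℕ} (hc : c ∈ colours n) :
    ∑ d ∈ colours n, (Q ^ (N + 1)) ^ (Colour.minDiff ⟨d.1, d.2⟩ ⟨c.1, c.2⟩).toNat *
        (q ^ ((d.2 : ℤ) - d.1) * chainValue q Q N (colourShift d)) =
      (1 - Q ^ (N + 1)) ^ 2 * chainValue q Q (N + 1) (colourShift c) := by
  obtain ⟨h₁, h₂⟩ := mem_colours.1 hc
  have hQ₀ : Q ≠ 0 := hQ ▸ pow_ne_zero _ hq₀
  have hQ' : ∀ m : ℕ, 0 < m → Q ^ m ≠ 1 := fun m hm => by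
    rw [hQ, ← pow_mul]
    exact hq _ (by positivity)
  have hW₁ : 1 - Q ^ (N + 1) ≠ 0 := sub_ne_zero.2 (hQ' _ N.succ_pos).symm
  have hW₀ := pow_ne_zero (N + 1) hQ₀
  -- The same `C` meets two demands: the jump required by `quasiPeriodic_diff`, and the compensation
  -- of the exceptional colour at the end.
  obtain ⟨C, hC⟩ : ∃ C, C * (1 - Q ^ (N + 1)) = Q ^ (N + 1) * lowerSum q Q N (-1) :=
    ⟨_, div_mul_cancel₀ _ hW₁⟩
  have hper := fun y => quasiPeriodic_add (q := q) hQ₀ (show 0 < n by omega) (N + 1) C y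
  have hdiff := fun d (hd : d ∈ colours n) => quasiPeriodic_diff hq₀ hq hn hQ N hC hd
  have hrange : -1 ≤ (c.1 : ℤ) + colourShift c ∧ (c.1 : ℤ) + colourShift c < n := by
    unfold colourShift
    split_ifs <;> omega
  have hval : quasiPeriodic q Q n (N + 1) C (colourShift c) =
      chainValue q Q (N + 1) (colourShift c) - (if c.1 < c.2 then C else C / Q ^ (N + 1)) := by
    have hs : (c.1 < c.2 ∧ 0 ≤ colourShift c ∨ ¬ c.1 < c.2 ∧ colourShift c < 0) ∧
        -n ≤ colourShift c ∧ colourShift c < n := by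
      unfold colourShift
      split_ifs <;> omega
    rcases hs.1 with ⟨h, h'⟩ | ⟨h, h'⟩
    · rw [if_pos h, chainValue, if_neg (by omega), quasiPeriodic_of_nonneg h' hs.2.2]
    · rw [if_neg h, chainValue, if_pos h', quasiPeriodic_of_neg hq₀ hQ hs.2.1 h']
  generalize quasiPeriodic q Q n (N + 1) C = V at hper hdiff hval
  generalize hW : Q ^ (N + 1) = W at *
  have main : ∑ d ∈ colours n, ((if c.1 ≤ d.1 then W else 1) *
      (if (d.2 : ℤ) ≤ c.1 + colourShift c then W else 1)) *
        (q ^ ((d.2 : ℤ) - d.1) * chainValue q Q N (colourShift d)) =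
      (1 - W) ^ 2 * V (colourShift c) := by
    have e₁ : ∀ k : ℕ, ∑ j ∈ Finset.range n, (if c.1 ≤ j then W else 1) *
        (V ((k : ℤ) - j - 2) - 2 * V ((k : ℤ) - j - 1) + V ((k : ℤ) - j)) =
        (1 - W) * (V ((k : ℤ) - c.1 - 1) - V ((k : ℤ) - c.1)) := by
      intro k
      rw [← sum_telescope_ge (g := fun y => V (y - 1) - V y) _ h₁]
      · refine Finset.sum_congr rfl fun j _ => ?_
        rw [show (k : ℤ) - j - 1 - 1 = k - j - 2 by ring]
        ring
      · intro y
        rw [show y + n - 1 = y - 1 + n by ring, hper, hper]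
        ring
    have e₂ := sum_telescope_le (g := fun y => V (y - c.1)) (W := W) (fun y => by
      rw [show y + n - (c.1 : ℤ) = y - c.1 + n by ring, hper]) hrange.1 hrange.2
    rw [add_sub_cancel_left] at e₂
    rw [pow_two, mul_assoc, ← e₂, Finset.mul_sum, colours, Finset.sum_product_right]
    refine Finset.sum_congr rfl fun k hk => ?_
    rw [mul_left_comm, show (k : ℤ) - 1 - c.1 = k - c.1 - 1 by ring, ← e₁, Finset.mul_sum]
    refine Finset.sum_congr rfl fun j hj => ?_
    rw [← hdiff (j, k) (mem_colours.2 ⟨Finset.mem_range.1 hj, Finset.mem_range.1 hk⟩)]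
    ring
  have hfree : colourShift (c.1, c.1) = -1 := by simp [colourShift]
  have hlow : chainValue q Q N (-1) = lowerSum q Q N (-1) := if_pos (by norm_num)
  have hmem : (c.1, c.1) ∈ colours n := mem_colours.2 ⟨h₁, h₁⟩
  simp only [pow_minDiff, add_mul]
  rw [Finset.sum_add_distrib, main]
  simp only [ite_mul, zero_mul]
  rw [Finset.sum_ite_eq' (colours n) (c.1, c.1), if_pos hmem, hfree, hval, hlow, sub_self,
    zpow_zero]
  split_ifs
  · linear_combination -(1 - W) * hC
  · field_simp
    linear_combination -hC

/-- The `q`-Vandermonde identity behind the Durfee square. -/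
theorem sum_durfee (hq : ∀ m : ℕ, 0 < m → q ^ m ≠ 1) (N m : ℕ) :
    ∑ s ∈ Finset.range (N + 1),
      q ^ (s * (s + m)) / (qFactorial q s * qFactorial q (s + m) * qFactorial q (N - s)) =
      1 / (qFactorial q N * qFactorial q (N + m)) := by
  have hf := qFactorial_ne_zero hq
  have hs : ∀ s : ℕ, 1 - q ^ (s + 1) ≠ 0 := fun s => sub_ne_zero.2 (hq _ s.succ_pos).symm
  induction N generalizing m with
  | zero => simp [qFactorial_zero]
  | succ N ih =>
    apply mul_left_cancel₀ (hs N)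
    -- Split `1 - q^(N+1) = (1 - q^(N+1-s)) + q^(N+1-s) * (1 - q^s)`. The first half leads to the
    -- sum for `(N, m)`; the second, after shifting `s`, leads to the one for `(N, m + 1)`, hence
    -- the induction for all `m`.
    have e₁ : ∀ s ∈ Finset.range (N + 2), (1 - q ^ (N + 1)) * (q ^ (s * (s + m)) /
        (qFactorial q s * qFactorial q (s + m) * qFactorial q (N + 1 - s))) =
        (1 - q ^ (N + 1 - s)) * (q ^ (s * (s + m)) /
        (qFactorial q s * qFactorial q (s + m) * qFactorial q (N + 1 - s))) +
        q ^ (N + 1 - s) * (1 - q ^ s) * (q ^ (s * (s + m)) /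
        (qFactorial q s * qFactorial q (s + m) * qFactorial q (N + 1 - s))) := by
      intro s h
      have : q ^ (N + 1) = q ^ (N + 1 - s) * q ^ s := by
        rw [← pow_add, Nat.sub_add_cancel (Nat.lt_succ_iff.1 (Finset.mem_range.1 h))]
      rw [this]
      ring
    rw [Finset.mul_sum, Finset.sum_congr rfl e₁, Finset.sum_add_distrib, Finset.sum_range_succ,
      Finset.sum_range_succ' (fun s => q ^ (N + 1 - s) * (1 - q ^ s) * _)]
    simp only [Nat.sub_self, pow_zero, sub_self, zero_mul, mul_zero, add_zero]
    have e₂ : ∑ s ∈ Finset.range (N + 1), (1 - q ^ (N + 1 - s)) * (q ^ (s * (s + m)) /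
        (qFactorial q s * qFactorial q (s + m) * qFactorial q (N + 1 - s))) =
        1 / (qFactorial q N * qFactorial q (N + m)) := by
      rw [← ih m]
      refine Finset.sum_congr rfl fun s h => ?_
      rw [show N + 1 - s = N - s + 1 by have := Finset.mem_range.1 h; omega, qFactorial_succ]
      have := hf s
      have := hf (s + m)
      have := hf (N - s)
      have := hs (N - s)
      field_simp
    have e₃ : ∑ s ∈ Finset.range (N + 1), q ^ (N + 1 - (s + 1)) * (1 - q ^ (s + 1)) *
        (q ^ ((s + 1) * (s + 1 + m)) / (qFactorial q (s + 1) * qFactorial q (s + 1 + m) *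
          qFactorial q (N + 1 - (s + 1)))) =
        q ^ (N + m + 1) * (1 / (qFactorial q N * qFactorial q (N + (m + 1)))) := by
      rw [← ih (m + 1), Finset.mul_sum]
      refine Finset.sum_congr rfl fun s h => ?_
      have hs' : N + 1 - (s + 1) = N - s := by omega
      have hp : q ^ (N - s) * q ^ ((s + 1) * (s + 1 + m)) =
          q ^ (N + m + 1) * q ^ (s * (s + (m + 1))) := by
        obtain ⟨t, rfl⟩ := Nat.exists_eq_add_of_le (Nat.lt_succ_iff.1 (Finset.mem_range.1 h))
        rw [← pow_add, ← pow_add, Nat.add_sub_cancel_left]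
        congr 1
        ring
      rw [hs', qFactorial_succ q s, show s + 1 + m = s + (m + 1) by ring]
      rw [show s + 1 + m = s + (m + 1) by ring] at hp
      have := hf s
      have := hf (s + (m + 1))
      have := hf (N - s)
      have := hs s
      field_simp
      linear_combination hp
    rw [e₂, e₃, qFactorial_succ q N, show N + 1 + m = N + m + 1 by ring, ← add_assoc,
      qFactorial_succ q (N + m)]
    have := hf N
    have := hf (N + m)
    have := hs N
    have := hs (N + m)
    field_simp
    ring

end Algebra

/-! ### Independence of `n` for Primc partitions. -/

section Laurent

/-- The product `(1 - x ^ (a + 1)) ⋯ (1 - x ^ b)`. -/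
def qRatio {A : Type*} [CommRing A] (x : A) (a b : ℕ) : A :=
  ∏ j ∈ Finset.Ico a b, (1 - x ^ (j + 1))

theorem qFactorial_mul_qRatio {A : Type*} [CommRing A] (x : A) {a b : ℕ} (h : a ≤ b) :
    qFactorial x a * qRatio x a b = qFactorial x b :=
  Finset.prod_range_mul_prod_Ico _ h

theorem pow_dvd_qRatio_sub_one {A : Type*} [CommRing A] (x : A) {a b : ℕ} (h : a ≤ b) :
    x ^ (a + 1) ∣ qRatio x a b - 1 := by
  induction b, h using Nat.le_induction with
  | base => simp [qRatio]
  | succ b h ih =>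
    rw [qRatio, Finset.prod_Ico_succ_top h, ← qRatio]
    have : qRatio x a b * (1 - x ^ (b + 1)) - 1 =
        (qRatio x a b - 1) - qRatio x a b * x ^ (b + 1) := by ring
    rw [this]
    exact dvd_sub ih (Dvd.dvd.mul_left (pow_dvd_pow x (by omega)) _)

theorem map_qFactorial {A B : Type*} [CommRing A] [CommRing B] (f : A →+* B) (x : A) (N : ℕ) :
    f (qFactorial x N) = qFactorial (f x) N := by
  simp [qFactorial]

theorem map_qRatio {A B : Type*} [CommRing A] [CommRing B] (f : A →+* B) (x : A) (a b : ℕ) :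
    f (qRatio x a b) = qRatio (f x) a b := by
  simp [qRatio]

theorem isUnit_qFactorial_X (N : ℕ) : IsUnit (qFactorial (PowerSeries.X : ℚ⟦X⟧) N) := by
  rw [PowerSeries.isUnit_iff_constantCoeff, map_qFactorial]
  simp [qFactorial]

/-- The embedding of power series into Laurent series. -/
noncomputable def toLaurent : ℚ⟦X⟧ →+* ℚ⸨X⸩ := HahnSeries.ofPowerSeries ℤ ℚ

theorem toLaurent_injective : Function.Injective toLaurent :=
  HahnSeries.ofPowerSeries_injective

theorem toLaurent_X_ne_zero : toLaurent PowerSeries.X ≠ 0 := by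
  rw [Ne, map_eq_zero_iff _ toLaurent_injective]
  exact PowerSeries.X_ne_zero

theorem toLaurent_X_pow_ne_one (m : ℕ) (hm : 0 < m) : toLaurent PowerSeries.X ^ m ≠ 1 := by
  rw [← map_pow, Ne, map_eq_one_iff _ toLaurent_injective]
  intro h
  have := congrArg (PowerSeries.constantCoeff (R := ℚ)) h
  simp [hm.ne'] at this

theorem toLaurent_X_pow_pow_ne_one {n : ℕ} (hn : 0 < n) (m : ℕ) (hm : 0 < m) :
    (toLaurent PowerSeries.X ^ n) ^ m ≠ 1 := by
  rw [← pow_mul]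
  exact toLaurent_X_pow_ne_one _ (by positivity)

theorem chainSeries_zero (n : ℕ) (c : Colour) : chainSeries n 0 c = 1 := by
  rw [chainSeries, chainsAbove_zero, genSeries_nil]

/-- Once `fromSeries_eq` is inserted and the prefactor divided out, the recursion `chainSeries_succ`
is `chainValue_succ`. Laurent series supply the field and the negative powers of `q`. -/
theorem toLaurent_chainSeries {n : ℕ} (hn : 2 ≤ n) (N : ℕ) {c : ℕ × ℕ} (hc : c ∈ colours n) :
    toLaurent (chainSeries n N ⟨c.1, c.2⟩) =
      (toLaurent PowerSeries.X ^ n) ^ N * qFactorial (toLaurent PowerSeries.X ^ n) N *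
        chainValue (toLaurent PowerSeries.X) (toLaurent PowerSeries.X ^ n) N (colourShift c) := by
  have hq₀ := toLaurent_X_ne_zero
  have hq := toLaurent_X_pow_ne_one
  have hQ := toLaurent_X_pow_pow_ne_one (show 0 < n by omega)
  induction N generalizing c with
  | zero =>
    rw [chainSeries_zero, map_one, qFactorial_zero, chainValue, lowerSum_zero, upperSum_zero]
    simp
  | succ N ih =>
    have hW : (1 : ℚ⸨X⸩) - (toLaurent PowerSeries.X ^ n) ^ (N + 1) ≠ 0 :=
      sub_ne_zero.2 (hQ _ N.succ_pos).symm
    rw [chainSeries_succ, map_sum, qFactorial_succ]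
    have e := chainValue_succ hq₀ hq hn rfl N hc
    have : (toLaurent PowerSeries.X ^ n) ^ (N + 1) * (qFactorial (toLaurent PowerSeries.X ^ n) N *
        (1 - (toLaurent PowerSeries.X ^ n) ^ (N + 1))) *
        chainValue (toLaurent PowerSeries.X) (toLaurent PowerSeries.X ^ n) (N + 1)
          (colourShift c) = (toLaurent PowerSeries.X ^ n) ^ (N + 1) *
        qFactorial (toLaurent PowerSeries.X ^ n) N /
        (1 - (toLaurent PowerSeries.X ^ n) ^ (N + 1)) *
        ((1 - (toLaurent PowerSeries.X ^ n) ^ (N + 1)) ^ 2 *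
        chainValue (toLaurent PowerSeries.X) (toLaurent PowerSeries.X ^ n) (N + 1)
          (colourShift c)) := by
      field_simp
    rw [this, ← e, Finset.mul_sum]
    refine Finset.sum_congr rfl fun d hd => ?_
    have hd' := mem_colours.1 hd
    have e₁ := congrArg toLaurent (fromSeries_eq n N ⟨d.1, d.2⟩ hd')
    rw [map_mul, map_mul, ih hd, map_sub, map_one, map_pow, map_pow, pow_mul] at e₁
    rw [map_mul, map_pow, mul_assoc n, pow_mul, pow_mul]
    have e₂ : toLaurent PowerSeries.X ^ (n - d.1 + d.2) =
        toLaurent PowerSeries.X ^ n * toLaurent PowerSeries.X ^ ((d.2 : ℤ) - d.1) := by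
      rw [← zpow_natCast, ← zpow_natCast, ← zpow_add₀ hq₀]
      congr 1
      push_cast [hd'.1.le]
      ring
    simp only at e₁
    rw [e₂] at e₁
    generalize toLaurent PowerSeries.X ^ n = Q at *
    have e₃ : toLaurent (fromSeries n N ⟨d.1, d.2⟩) =
        Q * toLaurent PowerSeries.X ^ ((d.2 : ℤ) - d.1) * (Q ^ N * qFactorial Q N *
          chainValue (toLaurent PowerSeries.X) Q N (colourShift d)) / (1 - Q ^ (N + 1)) := by
      rw [eq_div_iff hW, ← e₁]
      ring
    rw [e₃]
    ring

/-- The generating function of the generalised Primc partitions with at most `M` parts. -/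
noncomputable def primcUpTo (n M : ℕ) : ℚ⟦X⟧ :=
  ∑ N ∈ Finset.range (M + 1), genSeries (primcOfLength n N) (dilatedWeight n)

/-- Since `Δ(d, a_0 b_0)` is `1` except for `d = a_0 b_0`, where it is `0`, a chain above `1` in
colour `a_0 b_0` consists of copies of that part followed by parts of size at least `2`. Lowering
all `M` parts by one turns the copies into zeros and leaves a Primc partition with at most `M`
parts. -/
theorem chainSeries_eq_primcUpTo {n : ℕ} (hn : 0 < n) (M : ℕ) :
    chainSeries n M ⟨0, 0⟩ = PowerSeries.X ^ (n * M) * primcUpTo n M := by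
  induction M with
  | zero => simp [chainSeries_zero, primcUpTo, genSeries_primcOfLength_zero]
  | succ M ih =>
    have h₀ : ((0, 0) : ℕ × ℕ) ∈ colours n := mem_colours.2 ⟨hn, hn⟩
    have e₁ : chainSeries n (M + 1) ⟨0, 0⟩ = PowerSeries.X ^ (n * (M + 1)) *
        (∑ d ∈ colours n, fromSeries n M ⟨d.1, d.2⟩) +
        (1 - PowerSeries.X ^ (n * (M + 1))) * fromSeries n M ⟨0, 0⟩ := by
      rw [chainSeries_succ, ← Finset.add_sum_erase _ _ h₀,
        ← Finset.add_sum_erase (colours n) (fun d => fromSeries n M ⟨d.1, d.2⟩) h₀,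
        mul_add (PowerSeries.X ^ (n * (M + 1))), Finset.mul_sum]
      have : ∀ d ∈ (colours n).erase (0, 0), PowerSeries.X ^ (n * (M + 1) *
          (Colour.minDiff ⟨d.1, d.2⟩ ⟨0, 0⟩).toNat) * fromSeries n M ⟨d.1, d.2⟩ =
          PowerSeries.X ^ (n * (M + 1)) * fromSeries n M ⟨d.1, d.2⟩ := by
        rintro ⟨i, k⟩ hd
        have hd := (Finset.mem_erase.1 hd).1
        have : Colour.minDiff ⟨i, k⟩ ⟨0, 0⟩ = 1 := by
          simp only [ne_eq, Prod.mk.injEq] at hd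
          rcases Nat.eq_zero_or_pos k with rfl | hk
          · have : i ≠ 0 := by omega
            simp [Colour.minDiff, this]
          · simp [Colour.minDiff, hk.ne']
        simp [this]
      rw [Finset.sum_congr rfl this]
      have : Colour.minDiff ⟨0, 0⟩ ⟨0, 0⟩ = 0 := by simp [Colour.minDiff]
      simp only [this]
      simp
      ring
    rw [e₁, fromSeries_eq n M ⟨0, 0⟩ ⟨hn, hn⟩, ih, ← genSeries_primcOfLength_succ, primcUpTo,
      primcUpTo, Finset.sum_range_succ _ (M + 1)]
    simp only [Nat.sub_zero, add_zero]
    ring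

theorem toLaurent_primcUpTo {n : ℕ} (hn : 0 < n) (M : ℕ) :
    toLaurent (primcUpTo n M) = qFactorial (toLaurent PowerSeries.X ^ n) M *
      lowerSum (toLaurent PowerSeries.X) (toLaurent PowerSeries.X ^ n) M (-1) := by
  have hq₀ := toLaurent_X_ne_zero
  have hq := toLaurent_X_pow_ne_one
  have e := congrArg toLaurent (chainSeries_eq_primcUpTo hn M)
  rw [map_mul, map_pow, pow_mul] at e
  apply mul_left_cancel₀ (pow_ne_zero M (pow_ne_zero n hq₀))
  rw [← e]
  rcases Nat.lt_or_ge n 2 with h | h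
  -- The argument of `quasiPeriodic_diff` needs a period of at least `2`. With a single colour the
  -- chains are counted directly, by `q^M / (q; q)_M`, and the Durfee identity identifies the
  -- result.
  · obtain rfl : n = 1 := by omega
    have e₁ : toLaurent (chainSeries 1 M ⟨0, 0⟩) * qFactorial (toLaurent PowerSeries.X) M =
        toLaurent PowerSeries.X ^ M := by
      clear e
      induction M with
      | zero => simp [chainSeries_zero, qFactorial_zero]
      | succ M ih =>
        have e₂ : chainSeries 1 (M + 1) ⟨0, 0⟩ = fromSeries 1 M ⟨0, 0⟩ := by
          rw [chainSeries_succ]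
          simp [colours, Colour.minDiff]
        have e₃ := congrArg toLaurent (fromSeries_eq 1 M ⟨0, 0⟩ ⟨one_pos, one_pos⟩)
        rw [map_mul, map_mul, map_sub, map_one, map_pow, map_pow] at e₃
        simp only [one_mul, Nat.sub_zero, add_zero, pow_one] at e₃
        rw [e₂, qFactorial_succ]
        linear_combination qFactorial (toLaurent PowerSeries.X) M * e₃ +
          toLaurent PowerSeries.X * ih
    have e₂ := sum_durfee hq M 0
    have hf := qFactorial_ne_zero hq M
    have e₃ : lowerSum (toLaurent PowerSeries.X) (toLaurent PowerSeries.X) M (-1) =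
        1 / (qFactorial (toLaurent PowerSeries.X) M * qFactorial (toLaurent PowerSeries.X) M) := by
      rw [add_zero] at e₂
      rw [← e₂, lowerSum]
      refine Finset.sum_congr rfl fun s _ => ?_
      rw [frobTerm, div_div, ← zpow_natCast _ (s * (s + 0))]
      congr 1
      · congr 1
        push_cast
        ring
      · rw [add_zero, pow_two]
    rw [pow_one, e₃, ← e₁]
    field_simp
  · rw [toLaurent_chainSeries (c := (0, 0)) h M (mem_colours.2 ⟨hn, hn⟩)]
    have : chainValue (toLaurent PowerSeries.X) (toLaurent PowerSeries.X ^ n) M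
        (colourShift (0, 0)) =
        lowerSum (toLaurent PowerSeries.X) (toLaurent PowerSeries.X ^ n) M (-1) := by
      simp [chainValue, colourShift]
    rw [this]
    ring

theorem primcUpTo_eq {n : ℕ} (hn : 0 < n) (M : ℕ) :
    qFactorial PowerSeries.X M ^ 2 * primcUpTo n M = ∑ s ∈ Finset.range (M + 1),
      PowerSeries.X ^ (s * s) * qRatio PowerSeries.X s M ^ 2 *
        qRatio (PowerSeries.X ^ n) (M - s) M := by
  apply toLaurent_injective
  rw [map_mul, map_pow, map_qFactorial, toLaurent_primcUpTo hn, map_sum, lowerSum,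
    Finset.mul_sum, Finset.mul_sum]
  refine Finset.sum_congr rfl fun s hs => ?_
  have hs : s ≤ M := Nat.lt_succ_iff.1 (Finset.mem_range.1 hs)
  rw [map_mul, map_mul, map_pow, map_pow, map_qRatio, map_qRatio, map_pow, frobTerm,
    ← qFactorial_mul_qRatio (toLaurent PowerSeries.X) hs,
    ← qFactorial_mul_qRatio (toLaurent PowerSeries.X ^ n) (Nat.sub_le M s), ← zpow_natCast _ (s * s)]
  have h₁ := qFactorial_ne_zero toLaurent_X_pow_ne_one s
  have h₂ := qFactorial_ne_zero (toLaurent_X_pow_pow_ne_one hn) (M - s)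
  have h₃ : (s : ℤ) * (s + 1) + s * (-1) = (s * s : ℕ) := by
    push_cast
    ring
  rw [h₃]
  field_simp

/-- The quotient `(X^m; X^m)_M / (X^m; X^m)_{M-s}` is `1` modulo `X^(M-s+1)`, and its cofactor
contains `X^(s^2)`. As `s^2 + M - s + 1 ≥ M + 1`, it can be replaced by `1` for `m = n` and for `m =
1`. -/
theorem X_pow_dvd_primcUpTo_sub {n : ℕ} (hn : 0 < n) (M : ℕ) :
    (PowerSeries.X : ℚ⟦X⟧) ^ (M + 1) ∣ primcUpTo n M - primcUpTo 1 M := by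
  rw [← (isUnit_qFactorial_X M |>.pow 2).dvd_mul_left, mul_sub, primcUpTo_eq hn,
    primcUpTo_eq one_pos, ← Finset.sum_sub_distrib]
  refine Finset.dvd_sum fun s hs => ?_
  have hs : s ≤ M := Nat.lt_succ_iff.1 (Finset.mem_range.1 hs)
  have key : ∀ m : ℕ, 0 < m → (PowerSeries.X : ℚ⟦X⟧) ^ (M + 1) ∣ PowerSeries.X ^ (s * s) *
      (qRatio (PowerSeries.X ^ m) (M - s) M - 1) := by
    intro m hm
    refine (pow_dvd_pow _ ?_).trans ((pow_add (PowerSeries.X : ℚ⟦X⟧) (s * s) (M - s + 1)).dvd.trans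
      (mul_dvd_mul_left _ ((pow_dvd_pow_of_dvd (dvd_pow_self _ hm.ne') _).trans
        (pow_dvd_qRatio_sub_one _ (Nat.sub_le M s)))))
    have := Nat.le_mul_self s
    omega
  have := dvd_mul_of_dvd_right (dvd_sub (key n hn) (key 1 one_pos))
    (qRatio (PowerSeries.X : ℚ⟦X⟧) s M ^ 2)
  convert this using 1
  ring

theorem coeff_genSeries_primc (n : ℕ) {e M : ℕ} (h : e ≤ M) :
    PowerSeries.coeff e (genSeries {L | IsPrimc n L} (dilatedWeight n)) =
      PowerSeries.coeff e (primcUpTo n M) := by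
  rw [primcUpTo, ← genSeries_biUnion, coeff_genSeries, coeff_genSeries]
  · congr 2
    ext L
    simp only [Set.mem_ofPred_eq, Set.mem_iUnion, primcOfLength, Finset.mem_range, exists_prop]
    constructor
    · rintro ⟨hL, he⟩
      have := length_le_dilatedWeight (isPrimc_iff.1 hL).1
      exact ⟨⟨L.length, by omega, hL, rfl⟩, he⟩
    · rintro ⟨⟨_, _, hL, _⟩, he⟩
      exact ⟨hL, he⟩
  · intro i _ j _ hij
    rw [Set.disjoint_left]
    rintro L ⟨_, h₁⟩ ⟨_, h₂⟩
    exact hij (h₁.symm.trans h₂)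
  · exact fun i _ => finiteFibres_of_admissible fun L hL => (isPrimc_iff.1 hL.1).1

/-- Primc's identity: the dilated generating function of the generalised Primc partitions does not
depend on `n`. -/
theorem genSeries_primc_eq {n : ℕ} (hn : 0 < n) :
    genSeries {L | IsPrimc n L} (dilatedWeight n) =
      genSeries {L | IsPrimc 1 L} (dilatedWeight 1) := by
  ext e
  rw [coeff_genSeries_primc n le_rfl, coeff_genSeries_primc 1 le_rfl, ← sub_eq_zero, ← map_sub]
  exact PowerSeries.X_pow_dvd_iff.1 (X_pow_dvd_primcUpTo_sub hn e) e e.lt_succ_self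

end Laurent

/-! ### The neighbour relation as an order. -/

section Relation

theorem Colour.minDiff_free_right {c : Colour} {i : ℕ} (h : ¬ (c.a = i ∧ c.b = i)) :
    Colour.minDiff c ⟨i, i⟩ = (if i ≤ c.a then 1 else 0) + (if c.b < i then 1 else 0) := by
  unfold Colour.minDiff
  simp only [and_true]
  split_ifs <;> omega

theorem Colour.minDiff_free_left {i : ℕ} {d : Colour} (h : ¬ (d.a = i ∧ d.b = i)) :
    Colour.minDiff ⟨i, i⟩ d = (if d.a < i then 1 else 0) + (if i ≤ d.b then 1 else 0) := by
  unfold Colour.minDiff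
  simp only [true_and]
  split_ifs <;> omega

theorem Colour.minDiff_free_free (i j : ℕ) :
    Colour.minDiff ⟨i, i⟩ ⟨j, j⟩ = if i = j then 0 else 1 := by
  unfold Colour.minDiff
  simp only [true_and, and_true]
  split_ifs <;> omega

theorem Colour.minDiff_bound_free {a b : ℕ} (h : a ≠ b) (i : ℕ) :
    Colour.minDiff ⟨a, b⟩ ⟨i, i⟩ = (if i ≤ a then 1 else 0) + (if b < i then 1 else 0) :=
  Colour.minDiff_free_right fun h' => h (h'.1.trans h'.2.symm)

theorem Colour.minDiff_free_bound {a b : ℕ} (h : a ≠ b) (i : ℕ) :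
    Colour.minDiff ⟨i, i⟩ ⟨a, b⟩ = (if a < i then 1 else 0) + (if i ≤ b then 1 else 0) :=
  Colour.minDiff_free_left fun h' => h (h'.1.trans h'.2.symm)

theorem Colour.minDiff_bound {c d : Colour} (hc : c.a ≠ c.b) (hd : d.a ≠ d.b) :
    Colour.minDiff c d = (if d.a ≤ c.a then 1 else 0) + (if c.b ≤ d.b then 1 else 0) := by
  unfold Colour.minDiff
  simp only [hc, false_and, if_false, hd, and_false]
  split_ifs <;> omega

/-- This makes `PrimcRel` transitive, so Primc partitions are pairwise related lists, and deleting
parts keeps them so. -/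
theorem Colour.minDiff_triangle (c d e : Colour) :
    Colour.minDiff c e ≤ Colour.minDiff c d + Colour.minDiff d e := by
  obtain ⟨a, b⟩ := c
  obtain ⟨a', b'⟩ := d
  obtain ⟨a'', b''⟩ := e
  rcases eq_or_ne a b with rfl | h₁ <;> rcases eq_or_ne a' b' with rfl | h₂ <;>
    rcases eq_or_ne a'' b'' with rfl | h₃ <;>
    simp only [Colour.minDiff_free_free, Colour.minDiff_bound_free, Colour.minDiff_free_bound,
      Colour.minDiff_bound, *, ne_eq, not_false_eq_true] <;>
    split_ifs <;> omega

theorem PrimcRel.trans {x y z : ColouredPart} (h : PrimcRel x y) (h' : PrimcRel y z) :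
    PrimcRel x z := by
  have := Colour.minDiff_triangle x.colour y.colour z.colour
  unfold PrimcRel at *
  omega

instance : IsTrans ColouredPart PrimcRel := ⟨fun _ _ _ => PrimcRel.trans⟩

theorem PrimcRel.antisymm {x y : ColouredPart} (h : PrimcRel x y) (h' : PrimcRel y x) : x = y := by
  have hs : x.size = y.size := le_antisymm h'.size_le h.size_le
  have h₁ := Colour.minDiff_nonneg x.colour y.colour
  have h₂ := Colour.minDiff_nonneg y.colour x.colour
  have e₁ : Colour.minDiff x.colour y.colour = 0 := by unfold PrimcRel at h; omega
  have e₂ : Colour.minDiff y.colour x.colour = 0 := by unfold PrimcRel at h'; omega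
  obtain ⟨p, a, b⟩ := x
  obtain ⟨p', a', b'⟩ := y
  apply ColouredPart.ext' hs <;> simp only at * <;>
  · rcases eq_or_ne a b with rfl | h₁ <;> rcases eq_or_ne a' b' with rfl | h₂ <;>
    simp only [Colour.minDiff_free_free, Colour.minDiff_bound_free, Colour.minDiff_free_bound,
      Colour.minDiff_bound, *, ne_eq, not_false_eq_true] at e₁ e₂ <;>
    split_ifs at e₁ e₂ <;> omega

theorem primcRel_self_iff {x : ColouredPart} : PrimcRel x x ↔ x.colour.a = x.colour.b := by
  unfold PrimcRel
  rw [sub_self]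
  constructor
  · intro h
    by_contra hx
    rw [Colour.minDiff_bound hx hx, if_pos le_rfl, if_pos le_rfl] at h
    norm_num at h
  · intro h
    obtain ⟨p, a, b⟩ := x
    simp only at h
    subst h
    simp [Colour.minDiff]

theorem isPrimc_iff_pairwise {n : ℕ} {L : List ColouredPart} :
    IsPrimc n L ↔ (∀ x ∈ L, Admissible n x) ∧ L.Pairwise PrimcRel := by
  rw [isPrimc_iff, List.isChain_iff_pairwise]

/-- The source of the intervals in Conditions 1 and 2: only these free colours fit beside a
different part of the same size. For free `x` the range is empty, so distinct free parts of equal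
size are never related. -/
theorem PrimcRel.bounds_right {x : ColouredPart} {r i : ℕ} (h : PrimcRel x ⟨r, i, i⟩)
    (hne : x ≠ ⟨r, i, i⟩) (hs : x.size = r) : x.colour.a < i ∧ i ≤ x.colour.b := by
  change Colour.minDiff x.colour ⟨i, i⟩ ≤ (x.size : ℤ) - r at h
  rw [hs, sub_self, Colour.minDiff_free_right (i := i) fun h' => hne (ColouredPart.ext' hs h'.1 h'.2)] at h
  split_ifs at h <;> omega

theorem PrimcRel.bounds_left {y : ColouredPart} {r i : ℕ} (h : PrimcRel ⟨r, i, i⟩ y)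
    (hne : y ≠ ⟨r, i, i⟩) (hs : y.size = r) : y.colour.b < i ∧ i ≤ y.colour.a := by
  change Colour.minDiff ⟨i, i⟩ y.colour ≤ (r : ℤ) - y.size at h
  rw [hs, sub_self, Colour.minDiff_free_left (i := i) fun h' => hne (ColouredPart.ext' hs h'.1 h'.2)] at h
  split_ifs at h <;> omega

end Relation

/-! ### The forbidden free colour between two bound parts. -/

section Forbidden

theorem mem_intervalDiff {u v u' v' : ℕ} {x : ℤ} : x ∈ intervalDiff u v u' v' ↔
    ((u : ℤ) + 1 ≤ x ∧ x ≤ v) ∧ ¬ ((u' : ℤ) + 1 ≤ x ∧ x ≤ v') :=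
  Iff.rfl

variable (δ : Colour → ℤ) (γ : Colour → Colour → ℤ)

/-- The index of the free colour that is forbidden for parts of size `r` between the parts `x`
and `y`; `none` stands for the absence of a part. -/
def forbIndex (r : ℕ) : Option ColouredPart → Option ColouredPart → ℤ
  | some x, some y =>
    if x.size = r then
      if y.size = r ∨ (y.size + 1 = r ∧ y.colour.a < y.colour.b) then γ x.colour y.colour
      else δ x.colour
    else if y.size = r then
      if x.size = r + 1 ∧ x.colour.b < x.colour.a then γ x.colour y.colour else δ y.colour
    -- With no neighbour of size `r`, the colour `a_0 b_0` fits. Choosing it here turns the ban on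
    -- `a_0 b_0` into a case of the forbidden colour.
    else 0
  | some x, none => if x.size = r then δ x.colour else 0
  | none, some y => if y.size = r then δ y.colour else 0
  | none, none => 0

/-- The bound part `x` precedes the free parts of size `r`. -/
def Precedes (r : ℕ) (x : ColouredPart) : Prop :=
  r < x.size ∨ (x.size = r ∧ x.colour.a < x.colour.b)

open Classical in
/-- The bound parts of a list. -/
noncomputable def boundParts (L : List ColouredPart) : List ColouredPart :=
  L.filter fun x => x.colour.IsBound

open Classical in
/-- The index of the free colour that is forbidden for the parts of size `r`, determined by the
bound parts of `L`. -/
noncomputable def forbidden (L : List ColouredPart) (r : ℕ) : ℤ :=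
  forbIndex δ γ r ((boundParts L).filter fun x => Precedes r x).getLast?
    ((boundParts L).filter fun x => ¬ Precedes r x).head?

theorem mem_boundParts {L : List ColouredPart} {x : ColouredPart} :
    x ∈ boundParts L ↔ x ∈ L ∧ x.colour.a ≠ x.colour.b :=
  List.mem_filter.trans (and_congr_right fun _ => @decide_eq_true_iff _ (Classical.propDecidable _))

theorem forbidden_congr {L M : List ColouredPart} (h : boundParts L = boundParts M) (r : ℕ) :
    forbidden δ γ L r = forbidden δ γ M r := by
  simp only [forbidden, h]

variable {δ γ}

theorem Precedes.of_rel {r i : ℕ} {x : ColouredPart} (h : PrimcRel x ⟨r, i, i⟩)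
    (hx : x.colour.a ≠ x.colour.b) : Precedes r x := by
  rcases h.size_le.lt_or_eq with h' | h'
  · exact Or.inl h'
  · have := h.bounds_right (by rintro rfl; exact hx rfl) h'.symm
    exact Or.inr ⟨h'.symm, by omega⟩

theorem not_precedes_of_rel {r i : ℕ} {y : ColouredPart} (h : PrimcRel ⟨r, i, i⟩ y)
    (hy : y.colour.a ≠ y.colour.b) : ¬ Precedes r y := by
  have h₁ := h.size_le
  simp only at h₁
  rintro (h' | ⟨h', h''⟩)
  · omega
  · have := h.bounds_left (by rintro rfl; exact hy rfl) h'
    omega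

/-- Between two bound neighbours, the forbidden free colour can be inserted. -/
theorem forbIndex_spec (hδ : Condition1 δ) (hγ : Condition2 γ) {n r : ℕ} (hn : 0 < n)
    {X Y : Option ColouredPart}
    (hX : ∀ x ∈ X, x.colour.a ≠ x.colour.b ∧ Precedes r x ∧ x.colour.a < n ∧ x.colour.b < n)
    (hY : ∀ y ∈ Y, y.colour.a ≠ y.colour.b ∧ ¬ Precedes r y ∧ y.colour.a < n ∧ y.colour.b < n)
    (hXY : ∀ x ∈ X, ∀ y ∈ Y, PrimcRel x y) :
    ∃ i : ℕ, i < n ∧ forbIndex δ γ r X Y = i ∧ (∀ x ∈ X, PrimcRel x ⟨r, i, i⟩) ∧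
      ∀ y ∈ Y, PrimcRel ⟨r, i, i⟩ y := by
  have hI : ∀ i : ℤ, forbIndex δ γ r X Y = i → 0 ≤ i → i < n →
      (∀ x ∈ X, (if i ≤ x.colour.a then 1 else 0) + (if (x.colour.b : ℤ) < i then 1 else 0) ≤
        (x.size : ℤ) - r) → (∀ y ∈ Y, (if (y.colour.a : ℤ) < i then 1 else 0) +
        (if i ≤ y.colour.b then 1 else 0) ≤ (r : ℤ) - y.size) →
      ∃ i : ℕ, i < n ∧ forbIndex δ γ r X Y = i ∧ (∀ x ∈ X, PrimcRel x ⟨r, i, i⟩) ∧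
        ∀ y ∈ Y, PrimcRel ⟨r, i, i⟩ y := by
    intro i h₁ h₂ h₃ h₄ h₅
    lift i to ℕ using h₂
    refine ⟨i, by exact_mod_cast h₃, h₁, fun x hx => ?_, fun y hy => ?_⟩
    · have := h₄ x hx
      have h' := (hX x hx).1
      rw [PrimcRel, Colour.minDiff_free_right (by omega)]
      exact_mod_cast this
    · have := h₅ y hy
      have h' := (hY y hy).1
      rw [PrimcRel, Colour.minDiff_free_left (by omega)]
      exact_mod_cast this
  rcases X with _ | ⟨p, k₁, l₁⟩ <;> rcases Y with _ | ⟨p', k₂, l₂⟩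
  · exact hI 0 rfl le_rfl (by omega) (by simp) (by simp)
  · have hy := hY _ rfl
    simp only [Precedes] at hy
    by_cases h : p' = r
    · have := hδ ⟨k₂, l₂⟩ hy.1
      simp only at this
      refine hI (δ ⟨k₂, l₂⟩) (if_pos h) (by omega) (by omega) (by simp) ?_
      rintro _ ⟨⟩
      simp only
      split_ifs <;> omega
    · refine hI 0 (if_neg h) le_rfl (by omega) (by simp) ?_
      rintro _ ⟨⟩
      simp only
      split_ifs <;> omega
  · have hx := hX _ rfl
    simp only [Precedes] at hx
    by_cases h : p = r
    · have := hδ ⟨k₁, l₁⟩ hx.1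
      simp only at this
      refine hI (δ ⟨k₁, l₁⟩) (if_pos h) (by omega) (by omega) ?_ (by simp)
      rintro _ ⟨⟩
      simp only
      split_ifs <;> omega
    · refine hI 0 (if_neg h) le_rfl (by omega) ?_ (by simp)
      rintro _ ⟨⟩
      simp only
      split_ifs <;> omega
  · have hx := hX _ rfl
    have hy := hY _ rfl
    have hxy := hXY _ rfl _ rfl
    simp only [Precedes] at hx hy
    simp only [PrimcRel] at hxy
    rw [Colour.minDiff_bound hx.1 hy.1] at hxy
    simp only at hxy
    have key : ∀ i : ℤ, forbIndex δ γ r (some ⟨p, k₁, l₁⟩) (some ⟨p', k₂, l₂⟩) = i → 0 ≤ i →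
        i < n → ((if i ≤ k₁ then 1 else 0) + (if (l₁ : ℤ) < i then 1 else 0) ≤ (p : ℤ) - r) →
        ((if (k₂ : ℤ) < i then 1 else 0) + (if i ≤ l₂ then 1 else 0) ≤ (r : ℤ) - p') → _ :=
      fun i h₁ h₂ h₃ h₄ h₅ => hI i h₁ h₂ h₃ (by rintro _ ⟨⟩; exact h₄) (by rintro _ ⟨⟩; exact h₅)
    by_cases h : p = r
    · by_cases h₂ : p' = r
      -- Equal sizes force `Δ = 0`, that is `k₁ < k₂` and `l₂ < l₁`.
      · have := hγ.up_down k₁ l₁ k₂ l₂ hx.1 hy.1 (by split_ifs at hxy <;> omega)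
        refine key (γ ⟨k₁, l₁⟩ ⟨k₂, l₂⟩) ((if_pos h).trans (if_pos (Or.inl h₂))) (by omega)
          (by omega) ?_ ?_ <;> split_ifs <;> omega
      · by_cases h₃ : p' + 1 = r ∧ k₂ < l₂
        · have := hγ.up_up k₁ l₁ k₂ l₂ (by omega) h₃.2 ?_
          · rw [mem_intervalDiff] at this
            refine key (γ ⟨k₁, l₁⟩ ⟨k₂, l₂⟩) ((if_pos h).trans (if_pos (Or.inr h₃))) (by omega)
              (by omega) ?_ ?_ <;> split_ifs <;> omega
          -- Sizes differing by `1` exclude `Δ = 2`, so `k₁ < k₂` or `l₂ < l₁`; accordingly `k₁ + 1`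
          -- or `l₁` escapes the removed interval.
          · by_cases h₄ : k₁ < k₂
            · exact ⟨k₁ + 1, mem_intervalDiff.2 (by omega)⟩
            · exact ⟨l₁, mem_intervalDiff.2 (by split_ifs at hxy <;> omega)⟩
        · have := hδ ⟨k₁, l₁⟩ hx.1
          simp only at this
          refine key (δ ⟨k₁, l₁⟩) ((if_pos h).trans (if_neg (by simp only; omega))) (by omega)
            (by omega) ?_ ?_ <;> split_ifs <;> omega
    · by_cases h₂ : p' = r
      · by_cases h₃ : p = r + 1 ∧ l₁ < k₁
        · have := hγ.down_down k₁ l₁ k₂ l₂ h₃.2 (by omega) ?_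
          · rw [mem_intervalDiff] at this
            refine key (γ ⟨k₁, l₁⟩ ⟨k₂, l₂⟩) ((if_neg h).trans ((if_pos h₂).trans (if_pos h₃)))
              (by omega) (by omega) ?_ ?_ <;> split_ifs <;> omega
          · by_cases h₄ : l₂ < l₁
            · exact ⟨l₂ + 1, mem_intervalDiff.2 (by omega)⟩
            · exact ⟨k₂, mem_intervalDiff.2 (by split_ifs at hxy <;> omega)⟩
        · have := hδ ⟨k₂, l₂⟩ hy.1
          simp only at this
          refine key (δ ⟨k₂, l₂⟩) ((if_neg h).trans ((if_pos h₂).trans (if_neg h₃)))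
            (by omega) (by omega) ?_ ?_ <;> split_ifs <;> omega
      · refine key 0 ((if_neg h).trans (if_neg h₂)) le_rfl (by omega) ?_ ?_ <;>
          split_ifs <;> omega

end Forbidden

/-! ### Locality of the forbidden colour. -/

section Local

variable {δ : Colour → ℤ} {γ : Colour → Colour → ℤ}

/-- A part of this kind leaves room below it for every free colour of size `r`, so it has no
influence on the choice. -/
theorem forbIndex_left {r : ℕ} {X : Option ColouredPart} (Y : Option ColouredPart)
    (h : ∀ x ∈ X, r < x.size ∧ ¬ (x.size = r + 1 ∧ x.colour.b < x.colour.a)) :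
    forbIndex δ γ r X Y = forbIndex δ γ r none Y := by
  rcases X with _ | x
  · rfl
  · obtain ⟨h₁, h₂⟩ := h x rfl
    rcases Y with _ | y
    · exact if_neg h₁.ne'
    · exact (if_neg h₁.ne').trans (by rw [if_neg h₂]; rfl)

theorem forbIndex_right {r : ℕ} (X : Option ColouredPart) {Y : Option ColouredPart}
    (h : ∀ y ∈ Y, y.size < r ∧ ¬ (y.size + 1 = r ∧ y.colour.a < y.colour.b)) :
    forbIndex δ γ r X Y = forbIndex δ γ r X none := by
  rcases Y with _ | y
  · rfl
  · obtain ⟨h₁, h₂⟩ := h y rfl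
    rcases X with _ | x
    · exact if_neg h₁.ne
    · exact if_congr Iff.rfl (if_neg (by omega)) (if_neg h₁.ne)

theorem PrimcRel.lt_of_free {r i s j : ℕ} (h : PrimcRel ⟨s, j, j⟩ ⟨r, i, i⟩)
    (hne : (⟨s, j, j⟩ : ColouredPart) ≠ ⟨r, i, i⟩) : r < s := by
  rcases h.size_le.lt_or_eq with h' | h'
  · exact h'
  · have := h.bounds_right hne h'.symm
    simp only at this
    omega

theorem eq_free {f : ColouredPart} (hf : f.colour.a = f.colour.b) :
    f = ⟨f.size, f.colour.a, f.colour.a⟩ :=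
  ColouredPart.ext' rfl rfl hf.symm

theorem boundParts_append (L M : List ColouredPart) :
    boundParts (L ++ M) = boundParts L ++ boundParts M :=
  List.filter_append ..

theorem boundParts_cons_free {f : ColouredPart} (hf : f.colour.a = f.colour.b)
    (L : List ColouredPart) : boundParts (f :: L) = boundParts L :=
  List.filter_cons_of_neg (fun h => @of_decide_eq_true _ (Classical.propDecidable _) h hf)

theorem boundParts_cons_bound {x : ColouredPart} (hx : x.colour.a ≠ x.colour.b)
    (L : List ColouredPart) : boundParts (x :: L) = x :: boundParts L :=
  List.filter_cons_of_pos (@decide_eq_true _ (Classical.propDecidable _) hx)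

/-- The forbidden colour for a free part depends only on its two neighbours. -/
theorem forbidden_eq_forbIndex {r i : ℕ} {L₁ L₂ : List ColouredPart}
    (hL : (L₁ ++ ⟨r, i, i⟩ :: L₂).Pairwise PrimcRel) (h₁ : ⟨r, i, i⟩ ∉ L₁)
    (h₂ : ⟨r, i, i⟩ ∉ L₂) :
    forbidden δ γ (L₁ ++ ⟨r, i, i⟩ :: L₂) r = forbIndex δ γ r L₁.getLast? L₂.head? := by
  obtain ⟨hp₁, hp₂, hp⟩ := List.pairwise_append.1 hL
  have hl : ∀ x ∈ L₁, PrimcRel x ⟨r, i, i⟩ := fun x hx => hp x hx _ List.mem_cons_self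
  have hr : ∀ y ∈ L₂, PrimcRel ⟨r, i, i⟩ y := fun y hy => (List.pairwise_cons.1 hp₂).1 y hy
  have hb : boundParts (L₁ ++ ⟨r, i, i⟩ :: L₂) = boundParts L₁ ++ boundParts L₂ := by
    rw [boundParts_append, boundParts_cons_free rfl]
  have hbl : ∀ x ∈ boundParts L₁, Precedes r x := fun x hx =>
    Precedes.of_rel (hl x (mem_boundParts.1 hx).1) (mem_boundParts.1 hx).2
  have hbr : ∀ y ∈ boundParts L₂, ¬ Precedes r y := fun y hy =>
    not_precedes_of_rel (hr y (mem_boundParts.1 hy).1) (mem_boundParts.1 hy).2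
  -- If the left neighbour is free, it is larger than `r`. A bound part before it has size above `r
  -- + 1`, or size `r + 1` and `a < b`. Neither of the two influences the index, so both sides equal
  -- the value at `none`.
  have left : ∀ Y, forbIndex δ γ r (boundParts L₁).getLast? Y =
      forbIndex δ γ r L₁.getLast? Y := by
    intro Y
    rcases List.eq_nil_or_concat L₁ with rfl | ⟨M, z, rfl⟩
    · rfl
    · by_cases hz : z.colour.a = z.colour.b
      · have hz' := eq_free hz
        have hlt : r < z.size := by
          have hzl := hl z (by simp)
          rw [hz'] at hzl
          refine hzl.lt_of_free fun h => h₁ ?_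
          rw [← h, ← hz']
          simp
        rw [forbIndex_left, forbIndex_left (X := (M.concat z).getLast?)]
        · simp only [List.concat_eq_append, List.getLast?_append, List.getLast?_singleton,
            Option.some_or, Option.mem_def, Option.some.injEq, forall_eq']
          omega
        · intro x hx
          have hx := List.mem_of_getLast? hx
          rw [mem_boundParts] at hx
          have hxM : x ∈ M := by
            rcases List.mem_append.1 (List.concat_eq_append ▸ hx.1) with h | h
            · exact h
            · rw [List.mem_singleton.1 h] at hx
              exact absurd hz hx.2
          have hxz : PrimcRel x z := by
            rw [List.concat_eq_append] at hp₁
            exact (List.pairwise_append.1 hp₁).2.2 x hxM z (by simp)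
          have := hxz.size_le
          refine ⟨by omega, fun hx' => ?_⟩
          rw [hz'] at hxz
          have := hxz.bounds_right (by rintro rfl; exact hx.2 rfl) (by omega)
          omega
      · rw [List.concat_eq_append, boundParts_append, boundParts_cons_bound hz,
          show boundParts [] = [] from rfl]
        simp
  have right : ∀ X, forbIndex δ γ r X (boundParts L₂).head? = forbIndex δ γ r X L₂.head? := by
    intro X
    rcases L₂ with _ | ⟨z, M⟩
    · rfl
    · by_cases hz : z.colour.a = z.colour.b
      · have hz' := eq_free hz
        have hlt : z.size < r := by
          have hzl := hr z (by simp)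
          rw [hz'] at hzl
          refine hzl.lt_of_free fun h => h₂ ?_
          rw [h, ← hz']
          simp
        rw [forbIndex_right, forbIndex_right (Y := (z :: M).head?)]
        · simp only [List.head?_cons, Option.mem_def, Option.some.injEq, forall_eq']
          omega
        · intro x hx
          have hx := List.mem_of_head? hx
          rw [mem_boundParts] at hx
          have hxM : x ∈ M := by
            rcases List.mem_cons.1 hx.1 with h | h
            · rw [h] at hx
              exact absurd hz hx.2
            · exact h
          have hzx : PrimcRel z x :=
            (List.pairwise_cons.1 (List.pairwise_cons.1 hp₂).2).1 x hxM
          have := hzx.size_le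
          refine ⟨by omega, fun hx' => ?_⟩
          rw [hz'] at hzx
          have := hzx.bounds_left (by rintro rfl; exact hx.2 rfl) (by omega)
          omega
      · rw [boundParts_cons_bound hz]
        simp
  rw [← left, ← right, forbidden, hb, List.filter_append, List.filter_append,
    List.filter_eq_self.2 (by simpa using hbl), List.filter_eq_nil_iff.2 (by simpa using hbr),
    List.filter_eq_nil_iff.2 (by simpa using hbl), List.filter_eq_self.2 (by simpa using hbr),
    List.append_nil, List.nil_append]

end Local

/-! ### The pattern conditions restated through the forbidden colour. -/

section Characterisation

variable {δ : Colour → ℤ} {γ : Colour → Colour → ℤ} {n : ℕ} {L : List ColouredPart}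

/-- By antisymmetry, being related and distinct is a transitive relation, so it suffices to look at
adjacent parts. -/
theorem nodup_of_no_repeat (hL : L.Pairwise PrimcRel)
    (h : ∀ f : ColouredPart, f.colour.a = f.colour.b → ¬ [f, f] <:+: L) : L.Nodup := by
  have : L.IsChain fun x y => PrimcRel x y ∧ x ≠ y := by
    rw [List.isChain_iff_forall_rel_of_append_cons_cons]
    intro a b l₁ l₂ hl
    have hab : PrimcRel a b :=
      (List.isChain_iff_forall_rel_of_append_cons_cons.1 hL.isChain) hl
    refine ⟨hab, ?_⟩
    rintro rfl
    exact h a (primcRel_self_iff.1 hab) ⟨l₁, l₂, by simp [hl]⟩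
  have tr : IsTrans ColouredPart fun x y => PrimcRel x y ∧ x ≠ y :=
    ⟨fun x y z hxy hyz => ⟨hxy.1.trans hyz.1, by
      rintro rfl
      exact hxy.2 (hxy.1.antisymm hyz.1)⟩⟩
  exact (List.isChain_iff_pairwise.1 this).imp fun h => h.2

/-- The condition that every free part avoids the colour determined by its neighbours. -/
def AvoidsLocally (δ : Colour → ℤ) (γ : Colour → Colour → ℤ) (L : List ColouredPart) : Prop :=
  ∀ (r i : ℕ) (L₁ L₂ : List ColouredPart), L = L₁ ++ ⟨r, i, i⟩ :: L₂ →
    forbIndex δ γ r L₁.getLast? L₂.head? ≠ i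

theorem IsCapparelli.nodup (h : IsCapparelli n δ γ L) : L.Nodup := by
  obtain ⟨ha, hp⟩ := isPrimc_iff_pairwise.1 h.primc
  refine nodup_of_no_repeat hp fun f hf hff => ?_
  have hmem : f ∈ L := hff.subset (by simp)
  have hadm := ha f hmem
  rw [eq_free hf] at hff
  rcases Nat.eq_zero_or_pos f.colour.a with h₀ | h₀
  · refine h.no_zero f hmem ?_
    rw [eq_free hf, h₀]
  · exact h.no_repeat f.size f.colour.a hadm.1 h₀ hadm.2.1 hff

/-- Every branch of `forbIndex` is one excluded pattern or the ban on `a_0 b_0`. The relations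
between the three parts supply the side conditions of the pattern, and `i` itself witnesses that the
set difference is nonempty. -/
theorem IsCapparelli.avoidsLocally (h : IsCapparelli n δ γ L) : AvoidsLocally δ γ L := by
  obtain ⟨ha, hp⟩ := isPrimc_iff_pairwise.1 h.primc
  have hnd := h.nodup
  intro r i L₁ L₂ hL hi
  have hf : (⟨r, i, i⟩ : ColouredPart) ∈ L := by simp [hL]
  have hr : 0 < r := (ha _ hf).1
  have hzero : (0 : ℤ) ≠ i := by
    intro h₀
    have : i = 0 := by omega
    subst this
    exact h.no_zero _ hf rfl
  rw [hL] at hp hnd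
  obtain ⟨-, hp₂, hp₃⟩ := List.pairwise_append.1 hp
  obtain ⟨-, hd₂, hd₃⟩ := List.nodup_append.1 hnd
  have hl : ∀ x ∈ L₁, PrimcRel x ⟨r, i, i⟩ ∧ x ≠ ⟨r, i, i⟩ := fun x hx =>
    ⟨hp₃ x hx _ List.mem_cons_self, hd₃ x hx _ List.mem_cons_self⟩
  have hr' : ∀ y ∈ L₂, PrimcRel ⟨r, i, i⟩ y ∧ y ≠ ⟨r, i, i⟩ := fun y hy =>
    ⟨(List.pairwise_cons.1 hp₂).1 y hy, fun e => (List.nodup_cons.1 hd₂).1 (e ▸ hy)⟩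
  have hxy : ∀ x ∈ L₁, ∀ y ∈ L₂, PrimcRel x y := fun x hx y hy =>
    (hl x hx).1.trans (hr' y hy).1
  rcases List.eq_nil_or_concat L₁ with rfl | ⟨M₁, ⟨p, k₁, l₁⟩, rfl⟩
  · rcases L₂ with _ | ⟨⟨p', k₂, l₂⟩, M₂⟩
    · exact hzero hi
    · simp only [List.getLast?_nil, List.head?_cons, forbIndex] at hi
      split_ifs at hi with h₁
      · subst h₁
        have b := (hr' _ List.mem_cons_self).1.bounds_left (hr' _ List.mem_cons_self).2 rfl
        exact h.avoid_left_start p' k₂ l₂ i hr (by simp only at b; omega) hi.symm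
          ⟨M₂, by simp [hL]⟩
      · exact hzero hi
  · have hx : (⟨p, k₁, l₁⟩ : ColouredPart) ∈ M₁.concat ⟨p, k₁, l₁⟩ := by simp
    have hlx := hl _ hx
    have hpr : r ≤ p := hlx.1.size_le
    rw [List.concat_eq_append] at hL hi
    rw [List.getLast?_append, List.getLast?_singleton, Option.some_or] at hi
    rcases L₂ with _ | ⟨⟨p', k₂, l₂⟩, M₂⟩
    · simp only [List.head?_nil, forbIndex] at hi
      split_ifs at hi with h₁
      · subst h₁
        have b := hlx.1.bounds_right hlx.2 rfl
        exact h.avoid_right_end p k₁ l₁ i hr (by simp only at b; omega) hi.symm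
          ⟨M₁, by simp [hL]⟩
      · exact hzero hi
    · have hy : (⟨p', k₂, l₂⟩ : ColouredPart) ∈ (⟨p', k₂, l₂⟩ :: M₂ : List ColouredPart) :=
        List.mem_cons_self
      have hry := hr' _ hy
      have hpr' : p' ≤ r := hry.1.size_le
      have hp' : 0 < p' := (ha ⟨p', k₂, l₂⟩ (by simp [hL])).1
      have hinf : ([⟨p, k₁, l₁⟩, ⟨r, i, i⟩, ⟨p', k₂, l₂⟩] : List ColouredPart) <:+: L :=
        ⟨M₁, M₂, by simp [hL]⟩
      have hrel := hxy _ hx _ hy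
      simp only [List.head?_cons, forbIndex] at hi
      split_ifs at hi with h₁ h₂ h₃ h₄
      · subst h₁
        have b := hlx.1.bounds_right hlx.2 rfl
        simp only at b
        rcases h₂ with h₂ | ⟨h₂, h₃⟩
        · subst h₂
          have b' := hry.1.bounds_left hry.2 rfl
          simp only at b'
          refine h.avoid_mid p' k₁ l₁ k₂ l₂ i hr ?_ hi.symm hinf
          simp only [PrimcRel] at hrel
          rw [Colour.minDiff_bound (by simp only; omega) (by simp only; omega)] at hrel
          simp only at hrel
          split_ifs at hrel <;> omega
        · subst h₂
          refine h.avoid_right_up p' k₁ l₁ k₂ l₂ i hp' (by omega) h₃ ⟨i, ?_⟩ hi.symm hinf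
          have hb := hry.1
          simp only [PrimcRel] at hb
          rw [Colour.minDiff_free_bound (by omega)] at hb
          rw [mem_intervalDiff]
          split_ifs at hb <;> omega
      · subst h₁
        have b := hlx.1.bounds_right hlx.2 rfl
        simp only at b
        by_cases h₃ : p' + 1 = p
        · subst h₃
          exact h.avoid_right_down p' k₁ l₁ k₂ l₂ i hp' (by omega) (by omega) hi.symm hinf
        · obtain ⟨u, rfl⟩ := Nat.exists_eq_add_of_le hpr'
          exact h.avoid_right_far p' u k₁ l₁ k₂ l₂ i hp' (by omega) (by omega) hi.symm hinf
      · subst h₃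
        have b' := hry.1.bounds_left hry.2 rfl
        simp only at b'
        obtain ⟨h₄, h₅⟩ := h₄
        subst h₄
        refine h.avoid_left_down p' k₁ l₁ k₂ l₂ i hr (by omega) h₅ ⟨i, ?_⟩ hi.symm hinf
        have hb := hlx.1
        simp only [PrimcRel] at hb
        rw [Colour.minDiff_bound_free (by omega)] at hb
        rw [mem_intervalDiff]
        split_ifs at hb <;> omega
      · subst h₃
        have b' := hry.1.bounds_left hry.2 rfl
        simp only at b'
        by_cases h₅ : p = p' + 1
        · subst h₅
          exact h.avoid_left_up p' k₁ l₁ k₂ l₂ i hr (by omega) (by omega) hi.symm hinf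
        · obtain ⟨u, rfl⟩ := Nat.exists_eq_add_of_le hpr
          exact h.avoid_left_far p' u k₁ l₁ k₂ l₂ i hr (by omega) (by omega) hi.symm hinf
      · exact hzero hi

theorem AvoidsLocally.ne_of_infix (h : AvoidsLocally δ γ L) {r i : ℕ} {x y : ColouredPart}
    (hinf : [x, ⟨r, i, i⟩, y] <:+: L) : forbIndex δ γ r (some x) (some y) ≠ i := by
  obtain ⟨s, t, hst⟩ := hinf
  have := h r i (s ++ [x]) (y :: t) (by simp [← hst])
  simpa using this

theorem isCapparelli_of_avoidsLocally (hL : IsPrimc n L) (hnd : L.Nodup)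
    (h : AvoidsLocally δ γ L) : IsCapparelli n δ γ L := by
  have hp := (isPrimc_iff_pairwise.1 hL).2
  refine ⟨hL, ?_, ?_, ?_, ?_, ?_, ?_, ?_, ?_, ?_, ?_, ?_⟩
  · rintro ⟨r, c⟩ hx rfl
    obtain ⟨L₁, L₂, rfl⟩ := List.append_of_mem hx
    refine h r 0 L₁ L₂ rfl ?_
    obtain ⟨-, hp₂, hp₃⟩ := List.pairwise_append.1 hp
    obtain ⟨-, hd₂, hd₃⟩ := List.nodup_append.1 hnd
    -- A neighbour of size `r` would need a colour index below `0`, so around a part coloured `a_0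
    -- b_0` the index takes its default value `0`.
    have hl : ∀ x ∈ L₁.getLast?, x.size ≠ r := by
      intro x hx hs
      have hx := List.mem_of_getLast? hx
      have := (hp₃ x hx _ List.mem_cons_self).bounds_right (hd₃ x hx _ List.mem_cons_self) hs
      omega
    have hr : ∀ y ∈ L₂.head?, y.size ≠ r := by
      intro y hy hs
      have hy := List.mem_of_head? hy
      have := ((List.pairwise_cons.1 hp₂).1 y hy).bounds_left
        (fun e => (List.nodup_cons.1 hd₂).1 (e ▸ hy)) hs
      omega
    generalize L₁.getLast? = X at hl ⊢
    generalize L₂.head? = Y at hr ⊢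
    rcases X with _ | x <;> rcases Y with _ | y
    · rfl
    · exact if_neg (hr y rfl)
    · exact if_neg (hl x rfl)
    · exact (if_neg (hl x rfl)).trans (if_neg (hr y rfl))
  · intro p i _ _ _ hinf
    have := hinf.sublist.nodup hnd
    simp at this
  · intro p k₁ l₁ k₂ l₂ i hp hlt hi hinf
    refine h.ne_of_infix hinf ?_
    simp [forbIndex, hi]
  · intro p u k₁ l₁ k₂ l₂ i hp hlt hu hi hinf
    refine h.ne_of_infix hinf ?_
    simp only [forbIndex]
    rw [if_neg (by omega), if_pos trivial, if_neg (by omega), hi]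
  · rintro p k₂ l₂ i hp hlt hi ⟨t, ht⟩
    have := h p i [] (⟨p, k₂, l₂⟩ :: t) (by simp [← ht])
    simp [forbIndex, hi] at this
  · intro p k₁ l₁ k₂ l₂ i hp hlt hle hi hinf
    refine h.ne_of_infix hinf ?_
    simp only [forbIndex]
    rw [if_neg (by omega), if_pos trivial, if_neg (by omega), hi]
  · intro p k₁ l₁ k₂ l₂ i hp hlt hlt' _ hi hinf
    refine h.ne_of_infix hinf ?_
    simp only [forbIndex]
    rw [if_neg (by omega), if_pos trivial, if_pos (by simp [hlt']), hi]
  · intro p u k₁ l₁ k₂ l₂ i hp hlt hu hi hinf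
    refine h.ne_of_infix hinf ?_
    simp only [forbIndex]
    rw [if_pos trivial, if_neg (by omega), hi]
  · rintro p k₁ l₁ i hp hlt hi ⟨t, ht⟩
    have := h p i (t ++ [⟨p, k₁, l₁⟩]) [] (by simp [← ht])
    simp [forbIndex, hi] at this
  · intro p k₁ l₁ k₂ l₂ i hp hlt hle hi hinf
    refine h.ne_of_infix hinf ?_
    simp only [forbIndex]
    rw [if_pos trivial, if_neg (by omega), hi]
  · intro p k₁ l₁ k₂ l₂ i hp hlt hlt' _ hi hinf
    refine h.ne_of_infix hinf ?_
    simp only [forbIndex]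
    rw [if_pos trivial, if_pos (by simp [hlt']), hi]

/-- The generalised Capparelli partitions are the generalised Primc partitions without repeated
parts, in which no free part has the forbidden colour. -/
theorem isCapparelli_iff : IsCapparelli n δ γ L ↔ IsPrimc n L ∧ L.Nodup ∧
    ∀ f ∈ L, f.colour.a = f.colour.b → forbidden δ γ L f.size ≠ f.colour.a := by
  constructor
  · intro h
    refine ⟨h.primc, h.nodup, fun f hf hfree => ?_⟩
    obtain ⟨L₁, L₂, rfl⟩ := List.append_of_mem hf
    obtain ⟨-, hd₂, hd₃⟩ := List.nodup_append.1 h.nodup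
    have h₁ : f ∉ L₁ := fun hf => hd₃ f hf f List.mem_cons_self rfl
    have h₂ : f ∉ L₂ := (List.nodup_cons.1 hd₂).1
    have hp := (isPrimc_iff_pairwise.1 h.primc).2
    have hav := h.avoidsLocally f.size f.colour.a L₁ L₂ (by rw [← eq_free hfree])
    rw [eq_free hfree] at hp h₁ h₂
    rw [eq_free hfree]
    rw [← forbidden_eq_forbIndex hp h₁ h₂] at hav
    exact hav
  · rintro ⟨hL, hnd, h⟩
    refine isCapparelli_of_avoidsLocally hL hnd ?_
    rintro r i L₁ L₂ rfl
    obtain ⟨-, hd₂, hd₃⟩ := List.nodup_append.1 hnd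
    rw [← forbidden_eq_forbIndex (isPrimc_iff_pairwise.1 hL).2
      (fun hf => hd₃ _ hf _ List.mem_cons_self rfl) (List.nodup_cons.1 hd₂).1]
    exact h ⟨r, i, i⟩ (by simp) rfl

end Characterisation

/-! ### Sorting pairwise comparable elements. -/

section Sorting

variable {α : Type*} {R : α → α → Prop}

theorem exists_perm_pairwise_cons (htrans : ∀ {x y z}, R x y → R y z → R x z) (x : α)
    {l : List α} (hl : l.Pairwise R) (h : ∀ y ∈ l, R x y ∨ R y x) :
    ∃ l' : List α, l'.Perm (x :: l) ∧ l'.Pairwise R := by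
  induction l with
  | nil => exact ⟨[x], List.Perm.refl _, List.pairwise_singleton _ _⟩
  | cons y l ih =>
    obtain ⟨h₁, h₂⟩ := List.pairwise_cons.1 hl
    rcases h y List.mem_cons_self with hxy | hyx
    · refine ⟨x :: y :: l, List.Perm.refl _, List.pairwise_cons.2 ⟨fun z hz => ?_, hl⟩⟩
      rcases List.mem_cons.1 hz with rfl | hz
      · exact hxy
      · exact htrans hxy (h₁ z hz)
    · obtain ⟨l', hl', hp⟩ := ih h₂ fun z hz => h z (List.mem_cons_of_mem _ hz)
      refine ⟨y :: l', (hl'.cons y).trans (List.Perm.swap x y l),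
        List.pairwise_cons.2 ⟨fun z hz => ?_, hp⟩⟩
      rcases List.mem_cons.1 (hl'.mem_iff.1 hz) with rfl | hz
      · exact hyx
      · exact h₁ z hz

/-- Insertion sort. Comparability is assumed only between the listed elements, since `PrimcRel` is
neither total nor reflexive: a bound part is not related to itself. -/
theorem exists_perm_pairwise (htrans : ∀ {x y z}, R x y → R y z → R x z) {l : List α}
    (h : l.Pairwise fun x y => R x y ∨ R y x) : ∃ l' : List α, l'.Perm l ∧ l'.Pairwise R := by
  induction l with
  | nil => exact ⟨[], List.Perm.refl _, List.Pairwise.nil⟩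
  | cons x l ih =>
    obtain ⟨h₁, h₂⟩ := List.pairwise_cons.1 h
    obtain ⟨l', hl', hp⟩ := ih h₂
    obtain ⟨l'', hl'', hp'⟩ := exists_perm_pairwise_cons (R := R) (fun h h' => htrans h h') x hp
      fun y hy => h₁ y (hl'.mem_iff.1 hy)
    exact ⟨l'', hl''.trans (hl'.cons x), hp'⟩

end Sorting

theorem List.Perm.eq_of_primcRel {L M : List ColouredPart} (h : L.Perm M)
    (hL : L.Pairwise PrimcRel) (hM : M.Pairwise PrimcRel) : L = M :=
  h.eq_of_pairwise (fun _ _ _ _ => PrimcRel.antisymm) hL hM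

theorem PrimcRel.of_size_lt {r s i j : ℕ} (h : r < s) : PrimcRel ⟨s, j, j⟩ ⟨r, i, i⟩ := by
  rw [PrimcRel, Colour.minDiff_free_free]
  simp only
  split_ifs <;> omega

theorem eq_or_rel_of_pairwise {L : List ColouredPart} (hL : L.Pairwise PrimcRel)
    {x y : ColouredPart} (hx : x ∈ L) (hy : y ∈ L) : x = y ∨ PrimcRel x y ∨ PrimcRel y x := by
  induction L with
  | nil => simp at hx
  | cons z L ih =>
    obtain ⟨h₁, h₂⟩ := List.pairwise_cons.1 hL
    rcases List.mem_cons.1 hx with hx' | hx' <;> rcases List.mem_cons.1 hy with hy' | hy'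
    · exact Or.inl (hx'.trans hy'.symm)
    · exact Or.inr (Or.inl (hx' ▸ h₁ y hy'))
    · exact Or.inr (Or.inr (hy' ▸ h₁ x hx'))
    · exact ih h₂ hx' hy'

theorem eq_of_free_of_size {L : List ColouredPart} (hL : L.Pairwise PrimcRel) {r i j : ℕ}
    (hi : (⟨r, i, i⟩ : ColouredPart) ∈ L) (hj : (⟨r, j, j⟩ : ColouredPart) ∈ L) : i = j := by
  by_contra hij
  have hne : (⟨r, i, i⟩ : ColouredPart) ≠ ⟨r, j, j⟩ := by
    simpa using hij
  rcases eq_or_rel_of_pairwise hL hi hj with h | h | h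
  · exact hne h
  · exact lt_irrefl _ (h.lt_of_free hne)
  · exact lt_irrefl _ (h.lt_of_free hne.symm)

/-! ### Primc partitions as pairs of a Capparelli partition and a multiset of sizes. -/

section Insertion

variable (δ : Colour → ℤ) (γ : Colour → Colour → ℤ)

open Classical in
/-- The free part of size `r` whose multiplicity may be raised in `L`: the one that occurs in `L`,
or else the one of the forbidden colour. -/
noncomputable def freeRep (L : List ColouredPart) (r : ℕ) : ColouredPart :=
  if h : ∃ i, (⟨r, i, i⟩ : ColouredPart) ∈ L then ⟨r, h.choose, h.choose⟩
  else ⟨r, (forbidden δ γ L r).toNat, (forbidden δ γ L r).toNat⟩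

theorem freeRep_size (L : List ColouredPart) (r : ℕ) : (freeRep δ γ L r).size = r := by
  unfold freeRep
  split_ifs <;> rfl

theorem freeRep_free (L : List ColouredPart) (r : ℕ) :
    (freeRep δ γ L r).colour.a = (freeRep δ γ L r).colour.b := by
  unfold freeRep
  split_ifs <;> rfl

theorem freeRep_eq (L : List ColouredPart) (r : ℕ) : ∃ i, freeRep δ γ L r = ⟨r, i, i⟩ :=
  ⟨_, by conv_lhs => rw [eq_free (freeRep_free δ γ L r), freeRep_size]⟩

theorem freeRep_of_mem {L : List ColouredPart} (hL : L.Pairwise PrimcRel) {r i : ℕ}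
    (h : (⟨r, i, i⟩ : ColouredPart) ∈ L) : freeRep δ γ L r = ⟨r, i, i⟩ := by
  have h' : ∃ i, (⟨r, i, i⟩ : ColouredPart) ∈ L := ⟨i, h⟩
  rw [freeRep, dif_pos h', eq_of_free_of_size hL h'.choose_spec h]

theorem freeRep_of_notMem {L : List ColouredPart} {r i : ℕ}
    (h : ∀ j, (⟨r, j, j⟩ : ColouredPart) ∉ L) (hi : forbidden δ γ L r = i) :
    freeRep δ γ L r = ⟨r, i, i⟩ := by
  rw [freeRep, dif_neg (by simpa using h), hi, Int.toNat_natCast]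

variable {δ γ} {n : ℕ} {L : List ColouredPart}

/-- `forbIndex_spec` compares the free part with the two bound parts nearest to it; transitivity
extends this to all bound parts. -/
theorem forbidden_spec (hδ : Condition1 δ) (hγ : Condition2 γ) (hn : 0 < n) (hL : IsPrimc n L)
    (r : ℕ) : ∃ i : ℕ, i < n ∧ forbidden δ γ L r = i ∧ ∀ z ∈ L, z.colour.a ≠ z.colour.b →
      PrimcRel z ⟨r, i, i⟩ ∨ PrimcRel ⟨r, i, i⟩ z := by
  classical
  obtain ⟨ha, hp⟩ := isPrimc_iff_pairwise.1 hL
  have hpb : (boundParts L).Pairwise PrimcRel := hp.filter _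
  have hX : ∀ x ∈ (boundParts L).filter (fun x => Precedes r x), x.colour.a ≠ x.colour.b ∧
      Precedes r x ∧ x.colour.a < n ∧ x.colour.b < n := by
    intro x hx
    obtain ⟨h₁, h₂⟩ := List.mem_filter.1 hx
    obtain ⟨h₃, h₄⟩ := mem_boundParts.1 h₁
    exact ⟨h₄, of_decide_eq_true h₂, (ha x h₃).2⟩
  have hY : ∀ y ∈ (boundParts L).filter (fun x => ¬ Precedes r x), y.colour.a ≠ y.colour.b ∧
      ¬ Precedes r y ∧ y.colour.a < n ∧ y.colour.b < n := by
    intro x hx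
    obtain ⟨h₁, h₂⟩ := List.mem_filter.1 hx
    obtain ⟨h₃, h₄⟩ := mem_boundParts.1 h₁
    exact ⟨h₄, of_decide_eq_true h₂, (ha x h₃).2⟩
  have hXY : ∀ x ∈ (boundParts L).filter (fun x => Precedes r x),
      ∀ y ∈ (boundParts L).filter (fun x => ¬ Precedes r x), PrimcRel x y := by
    intro x hx y hy
    obtain ⟨hx₁, hx₂, -⟩ := hX x hx
    obtain ⟨hy₁, hy₂, -⟩ := hY y hy
    rcases eq_or_rel_of_pairwise hpb (List.mem_filter.1 hx).1 (List.mem_filter.1 hy).1 with h | h | h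
    · subst h
      exact absurd hx₂ hy₂
    · exact h
    · exfalso
      have hs := h.size_le
      unfold Precedes at hx₂ hy₂
      unfold PrimcRel at h
      rw [Colour.minDiff_bound hy₁ hx₁] at h
      split_ifs at h <;> omega
  obtain ⟨i, hi, he, h₁, h₂⟩ := forbIndex_spec hδ hγ hn (r := r)
    (X := ((boundParts L).filter fun x => Precedes r x).getLast?)
    (Y := ((boundParts L).filter fun x => ¬ Precedes r x).head?)
    (fun x hx => hX x (List.mem_of_getLast? hx)) (fun y hy => hY y (List.mem_of_head? hy))
    (fun x hx y hy => hXY x (List.mem_of_getLast? hx) y (List.mem_of_head? hy))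
  refine ⟨i, hi, ?_, fun z hz hzb => ?_⟩
  · rw [← he, forbidden]
  have hzb' := mem_boundParts.2 ⟨hz, hzb⟩
  by_cases hzr : Precedes r z
  · left
    have hz' : z ∈ (boundParts L).filter fun x => Precedes r x :=
      List.mem_filter.2 ⟨hzb', decide_eq_true hzr⟩
    have hpf : ((boundParts L).filter fun x => Precedes r x).Pairwise PrimcRel := hpb.filter _
    rcases List.eq_nil_or_concat ((boundParts L).filter fun x => Precedes r x) with h | ⟨M, x, h⟩
    · rw [h] at hz'
      simp at hz'
    · rw [h, List.concat_eq_append] at hz' hpf h₁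
      have hx := h₁ x (by simp)
      rcases List.mem_append.1 hz' with hz' | hz'
      · exact ((List.pairwise_append.1 hpf).2.2 z hz' x (by simp)).trans hx
      · rwa [List.mem_singleton.1 hz']
  · right
    have hz' : z ∈ (boundParts L).filter fun x => ¬ Precedes r x :=
      List.mem_filter.2 ⟨hzb', decide_eq_true hzr⟩
    have hpf : ((boundParts L).filter fun x => ¬ Precedes r x).Pairwise PrimcRel := hpb.filter _
    cases h : (boundParts L).filter fun x => ¬ Precedes r x with
    | nil =>
      rw [h] at hz'
      simp at hz'
    | cons y M =>
      rw [h] at hz' hpf h₂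
      have hy := h₂ y (by simp)
      rcases List.mem_cons.1 hz' with hz' | hz'
      · rwa [hz']
      · exact hy.trans ((List.pairwise_cons.1 hpf).1 z hz')

/-- Multisets of positive integers. -/
def positiveMultisets : Set (Multiset ℕ) := {μ | ∀ r ∈ μ, 0 < r}

/-- The parts of `L` together with the free parts of the sizes in `μ`. -/
noncomputable def adjoinFree (δ : Colour → ℤ) (γ : Colour → Colour → ℤ)
    (x : List ColouredPart × Multiset ℕ) : List ColouredPart :=
  x.1 ++ x.2.toList.map (freeRep δ γ x.1)

theorem adjoinFree_comparable (hδ : Condition1 δ) (hγ : Condition2 γ) (hn : 0 < n)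
    (hL : IsPrimc n L) (μ : Multiset ℕ) :
    (adjoinFree δ γ (L, μ)).Pairwise fun x y => PrimcRel x y ∨ PrimcRel y x := by
  have hp := (isPrimc_iff_pairwise.1 hL).2
  have hfree : ∀ {r s i j : ℕ}, (r = s → i = j) →
      PrimcRel ⟨r, i, i⟩ ⟨s, j, j⟩ ∨ PrimcRel ⟨s, j, j⟩ ⟨r, i, i⟩ := by
    intro r s i j h
    rcases lt_trichotomy r s with h' | h' | h'
    · exact Or.inr (PrimcRel.of_size_lt h')
    · subst h'
      rw [h rfl]
      exact Or.inl (primcRel_self_iff.2 rfl)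
    · exact Or.inl (PrimcRel.of_size_lt h')
  refine List.pairwise_append.2 ⟨hp.imp Or.inl, ?_, ?_⟩
  · rw [List.pairwise_map]
    refine List.pairwise_of_forall fun r s => ?_
    obtain ⟨i, hi⟩ := freeRep_eq δ γ L r
    obtain ⟨j, hj⟩ := freeRep_eq δ γ L s
    rw [hi, hj]
    refine hfree ?_
    rintro rfl
    rw [hi] at hj
    simpa using hj
  · intro x hx y hy
    obtain ⟨r, -, rfl⟩ := List.mem_map.1 hy
    simp only at hx
    by_cases h : ∃ i, (⟨r, i, i⟩ : ColouredPart) ∈ L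
    · obtain ⟨i, hi⟩ := h
      rw [freeRep_of_mem δ γ hp hi]
      rcases eq_or_rel_of_pairwise hp hx hi with rfl | h
      · exact Or.inl (primcRel_self_iff.2 rfl)
      · exact h
    · obtain ⟨i, -, he, hz⟩ := forbidden_spec hδ hγ hn hL r
      rw [freeRep_of_notMem δ γ (by simpa using h) he]
      by_cases hxb : x.colour.a = x.colour.b
      · rw [eq_free hxb] at hx ⊢
        refine hfree fun hs => ?_
        rw [hs] at hx
        exact absurd ⟨_, hx⟩ h
      · exact hz x hx hxb

open Classical in
/-- The generalised Primc partition made of the parts of `L` and the free parts of the sizes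
in `μ`. -/
noncomputable def insertFree (δ : Colour → ℤ) (γ : Colour → Colour → ℤ)
    (x : List ColouredPart × Multiset ℕ) : List ColouredPart :=
  if h : ∃ M : List ColouredPart, M.Perm (adjoinFree δ γ x) ∧ M.Pairwise PrimcRel then h.choose
  else []

theorem insertFree_spec (hδ : Condition1 δ) (hγ : Condition2 γ) (hn : 0 < n)
    (hL : IsPrimc n L) (μ : Multiset ℕ) :
    (insertFree δ γ (L, μ)).Perm (adjoinFree δ γ (L, μ)) ∧
      (insertFree δ γ (L, μ)).Pairwise PrimcRel := by
  have h := exists_perm_pairwise (R := PrimcRel) PrimcRel.trans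
    (adjoinFree_comparable hδ hγ hn hL μ)
  rw [insertFree, dif_pos h]
  exact h.choose_spec

theorem freeRep_lt (hδ : Condition1 δ) (hγ : Condition2 γ) (hn : 0 < n)
    (hL : IsPrimc n L) (r : ℕ) : (freeRep δ γ L r).colour.a < n := by
  by_cases h : ∃ i, (⟨r, i, i⟩ : ColouredPart) ∈ L
  · obtain ⟨i, hi⟩ := h
    have := ((isPrimc_iff_pairwise.1 hL).1 _ hi).2.1
    rwa [freeRep_of_mem δ γ (isPrimc_iff_pairwise.1 hL).2 hi]
  · obtain ⟨i, hi, he, -⟩ := forbidden_spec hδ hγ hn hL r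
    rwa [freeRep_of_notMem δ γ (by simpa using h) he]

theorem isPrimc_insertFree (hδ : Condition1 δ) (hγ : Condition2 γ) (hn : 0 < n)
    (hL : IsPrimc n L) {μ : Multiset ℕ} (hμ : μ ∈ positiveMultisets) :
    IsPrimc n (insertFree δ γ (L, μ)) := by
  obtain ⟨h₁, h₂⟩ := insertFree_spec hδ hγ hn hL μ
  refine isPrimc_iff_pairwise.2 ⟨fun x hx => ?_, h₂⟩
  rcases List.mem_append.1 (h₁.mem_iff.1 hx) with hx | hx
  · exact (isPrimc_iff_pairwise.1 hL).1 x hx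
  · obtain ⟨r, hr, rfl⟩ := List.mem_map.1 hx
    have := freeRep_lt hδ hγ hn hL r
    refine ⟨?_, this, ?_⟩
    · rw [freeRep_size]
      exact hμ r (Multiset.mem_toList.1 hr)
    · rwa [← freeRep_free]

theorem dilatedWeight_insertFree (hδ : Condition1 δ) (hγ : Condition2 γ) (hn : 0 < n)
    (hL : IsPrimc n L) (μ : Multiset ℕ) : dilatedWeight n (insertFree δ γ (L, μ)) =
      dilatedWeight n L + (n * μ.sum : ℕ) := by
  rw [dilatedWeight_perm n (insertFree_spec hδ hγ hn hL μ).1]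
  have : ∀ l : List ℕ, dilatedWeight n (l.map (freeRep δ γ L)) = (n * l.sum : ℕ) := by
    intro l
    induction l with
    | nil => simp [dilatedWeight_nil]
    | cons r l ih =>
      rw [List.map_cons, dilatedWeight_cons, ih, List.sum_cons, freeRep_size, freeRep_free]
      push_cast
      ring
  have h := this μ.toList
  rw [Multiset.sum_toList] at h
  rw [← h, adjoinFree, dilatedWeight, dilatedWeight, dilatedWeight, List.map_append,
    List.sum_append]

theorem boundParts_insertFree (hδ : Condition1 δ) (hγ : Condition2 γ) (hn : 0 < n)
    (hL : IsPrimc n L) (μ : Multiset ℕ) :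
    boundParts (insertFree δ γ (L, μ)) = boundParts L := by
  obtain ⟨h₁, h₂⟩ := insertFree_spec hδ hγ hn hL μ
  refine List.Perm.eq_of_primcRel ?_ (h₂.filter _) ((isPrimc_iff_pairwise.1 hL).2.filter _)
  have h₃ : boundParts (μ.toList.map (freeRep δ γ L)) = [] := by
    rw [List.eq_nil_iff_forall_not_mem]
    intro x hx
    obtain ⟨hx, hb⟩ := mem_boundParts.1 hx
    obtain ⟨r, -, rfl⟩ := List.mem_map.1 hx
    exact hb (freeRep_free δ γ L r)
  have h₄ : (boundParts (insertFree δ γ (L, μ))).Perm (boundParts (adjoinFree δ γ (L, μ))) :=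
    h₁.filter _
  rwa [adjoinFree, boundParts_append, h₃, List.append_nil] at h₄

/-- This recovers `L` from the enlarged partition. Insertion keeps the bound parts, hence the
forbidden colours, and an inserted part either copies a part of `L` or has the forbidden colour. -/
theorem mem_iff_of_insertFree (hδ : Condition1 δ) (hγ : Condition2 γ) (hn : 0 < n)
    (hL : IsCapparelli n δ γ L) (μ : Multiset ℕ) (f : ColouredPart) :
    f ∈ L ↔ f ∈ insertFree δ γ (L, μ) ∧
      (f.colour.a = f.colour.b → forbidden δ γ (insertFree δ γ (L, μ)) f.size ≠ f.colour.a) := by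
  obtain ⟨h₁, h₂⟩ := insertFree_spec hδ hγ hn hL.primc μ
  rw [forbidden_congr δ γ (boundParts_insertFree hδ hγ hn hL.primc μ), h₁.mem_iff, adjoinFree,
    List.mem_append]
  constructor
  · exact fun h => ⟨Or.inl h, (isCapparelli_iff.1 hL).2.2 f h⟩
  · rintro ⟨h | h, hf⟩
    · exact h
    · obtain ⟨r, -, rfl⟩ := List.mem_map.1 h
      have hf := hf (freeRep_free δ γ L r)
      by_cases h' : ∃ i, (⟨r, i, i⟩ : ColouredPart) ∈ L
      · obtain ⟨i, hi⟩ := h'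
        rwa [freeRep_of_mem δ γ (isPrimc_iff_pairwise.1 hL.primc).2 hi]
      · obtain ⟨i, -, he, -⟩ := forbidden_spec hδ hγ hn hL.primc r
        simp only at hf
        rw [freeRep_size, freeRep_of_notMem δ γ (by simpa using h') he] at hf
        exact absurd he hf

theorem injOn_insertFree (hδ : Condition1 δ) (hγ : Condition2 γ) (hn : 0 < n) :
    Set.InjOn (insertFree δ γ) ({L | IsCapparelli n δ γ L} ×ˢ positiveMultisets) := by
  rintro ⟨L, μ⟩ ⟨hL, -⟩ ⟨M, ν⟩ ⟨hM, -⟩ h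
  change IsCapparelli n δ γ L at hL
  change IsCapparelli n δ γ M at hM
  have hLM : L = M := by
    refine List.Perm.eq_of_primcRel ?_ (isPrimc_iff_pairwise.1 hL.primc).2
      (isPrimc_iff_pairwise.1 hM.primc).2
    refine (List.perm_ext_iff_of_nodup hL.nodup hM.nodup).2 fun f => ?_
    rw [mem_iff_of_insertFree hδ hγ hn hL μ, mem_iff_of_insertFree hδ hγ hn hM ν, h]
  subst hLM
  have h₁ := (insertFree_spec hδ hγ hn hL.primc μ).1
  have h₂ := (insertFree_spec hδ hγ hn hL.primc ν).1
  rw [h] at h₁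
  -- Once `L` is known, cancelling it leaves the inserted parts, whose sizes are the multiset.
  have h₃ := (List.perm_append_left_iff L).1 (h₁.symm.trans h₂)
  have h₄ := h₃.map ColouredPart.size
  simp only [List.map_map, Function.comp_def, freeRep_size, List.map_id'] at h₄
  rw [Prod.mk.injEq, ← Multiset.coe_toList μ, ← Multiset.coe_toList ν]
  exact ⟨rfl, Multiset.coe_eq_coe.2 h₄⟩

-- The preimage of `S` arises by deleting all free parts of forbidden colour and reducing the other
-- multiplicities to one; the sizes of the removed parts form the multiset.
open Classical in
theorem surjOn_insertFree (hδ : Condition1 δ) (hγ : Condition2 γ) (hn : 0 < n) :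
    Set.SurjOn (insertFree δ γ) ({L | IsCapparelli n δ γ L} ×ˢ positiveMultisets)
      {L | IsPrimc n L} := by
  intro S hS
  change IsPrimc n S at hS
  obtain ⟨ha, hp⟩ := isPrimc_iff_pairwise.1 hS
  obtain ⟨L, hLdef⟩ : ∃ L, L = (S.filter fun f =>
    f.colour.a = f.colour.b → forbidden δ γ S f.size ≠ f.colour.a).dedup := ⟨_, rfl⟩
  have hsub : L.Sublist S := by
    rw [hLdef]
    exact (List.dedup_sublist _).trans List.filter_sublist
  have hnd : L.Nodup := hLdef ▸ List.nodup_dedup _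
  have hmem : ∀ f, f ∈ L ↔ f ∈ S ∧
      (f.colour.a = f.colour.b → forbidden δ γ S f.size ≠ f.colour.a) := by
    intro f
    rw [hLdef, List.mem_dedup, List.mem_filter, decide_eq_true_iff]
  have hL : IsPrimc n L := isPrimc_iff_pairwise.2 ⟨fun x hx => ha x (hsub.subset hx), hp.sublist hsub⟩
  have hpL := (isPrimc_iff_pairwise.1 hL).2
  have hcount : ∀ f ∈ S, f.colour.a ≠ f.colour.b → S.count f ≤ 1 := by
    intro f _ hfb
    by_contra hc
    have hd : [f, f].Sublist S := List.replicate_sublist_iff.2 (show 2 ≤ S.count f by omega)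
    have := hp.sublist hd
    exact hfb (primcRel_self_iff.1 (by simpa using this))
  have hb : boundParts L = boundParts S := by
    refine List.Perm.eq_of_primcRel ?_ (hpL.filter _) (hp.filter _)
    refine (List.perm_ext_iff_of_nodup (hnd.filter _) ?_).2 fun f => ?_
    · rw [List.nodup_iff_count_le_one]
      intro f
      by_cases hf : f ∈ boundParts S
      · obtain ⟨h₁, h₂⟩ := mem_boundParts.1 hf
        exact (List.Sublist.count_le f List.filter_sublist).trans (hcount f h₁ h₂)
      · rw [List.count_eq_zero_of_not_mem hf]
        exact zero_le_one
    · change f ∈ boundParts L ↔ f ∈ boundParts S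
      rw [mem_boundParts, mem_boundParts, hmem]
      tauto
  have hforb := forbidden_congr δ γ hb
  have hcap : IsCapparelli n δ γ L := isCapparelli_iff.2 ⟨hL, hnd, fun f hf hff => by
    rw [hforb]
    exact ((hmem f).1 hf).2 hff⟩
  have hle : (L : Multiset ColouredPart) ≤ S := Multiset.coe_le.2 hsub.subperm
  -- A removed part is a surplus copy of a part of `L`, or it has the forbidden colour. In the
  -- second case `L` has no free part of that size, because in `S` the size of a free part
  -- determines its colour.
  have hrep : ∀ f ∈ (S : Multiset ColouredPart) - L, freeRep δ γ L f.size = f := by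
    intro f hf
    have hfS : f ∈ S := Multiset.mem_coe.1 (Multiset.mem_of_le (Multiset.sub_le_self _ _) hf)
    rw [Multiset.mem_sub, Multiset.coe_count, Multiset.coe_count] at hf
    have hff : f.colour.a = f.colour.b := by
      by_contra hff
      have h₁ := hcount f hfS hff
      have h₂ : 0 < L.count f := List.count_pos_iff.2 ((hmem f).2 ⟨hfS, fun h => absurd h hff⟩)
      omega
    have hf' := eq_free hff
    by_cases hfL : f ∈ L
    · rw [hf'] at hfL
      rw [freeRep_of_mem δ γ hpL hfL, ← hf']
    · have he : forbidden δ γ S f.size = f.colour.a := by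
        by_contra he
        exact hfL ((hmem f).2 ⟨hfS, fun _ => he⟩)
      rw [freeRep_of_notMem δ γ (i := f.colour.a) _ (by rw [hforb, he]), ← hf']
      intro j hj
      rw [hf'] at hfS
      have hji := eq_of_free_of_size hp (hsub.subset hj) hfS
      rw [hji, ← hf'] at hj
      exact hfL hj
  refine ⟨(L, ((S : Multiset ColouredPart) - L).map ColouredPart.size), ⟨hcap, ?_⟩, ?_⟩
  · intro r hr
    change r ∈ ((S : Multiset ColouredPart) - L).map ColouredPart.size at hr
    obtain ⟨f, hf, rfl⟩ := Multiset.mem_map.1 hr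
    exact (ha f (Multiset.mem_coe.1 (Multiset.mem_of_le (Multiset.sub_le_self _ _) hf))).1
  · obtain ⟨h₁, h₂⟩ := insertFree_spec hδ hγ hn hL
      (((S : Multiset ColouredPart) - L).map ColouredPart.size)
    refine List.Perm.eq_of_primcRel (h₁.trans ?_) h₂ hp
    rw [← Multiset.coe_eq_coe, adjoinFree, ← Multiset.coe_add, ← Multiset.map_coe,
      Multiset.coe_toList, Multiset.map_map]
    have hmap : ((S : Multiset ColouredPart) - L).map (freeRep δ γ L ∘ ColouredPart.size) =
        (S : Multiset ColouredPart) - L :=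
      (Multiset.map_congr rfl hrep).trans (Multiset.map_id' _)
    exact (congrArg _ hmap).trans (add_tsub_cancel_of_le hle)

theorem finiteFibres_positiveMultisets (hn : 0 < n) :
    FiniteFibres positiveMultisets fun μ => ((n * μ.sum : ℕ) : ℤ) := by
  intro e
  refine (Set.finite_range (fun p : Σ k : Fin (e + 1), Nat.Partition k => p.2.parts)).subset ?_
  rintro μ ⟨hμ, he⟩
  have h₁ : n * μ.sum = e := by
    simp only at he
    exact_mod_cast he
  have h₂ : μ.sum ≤ e := h₁ ▸ Nat.le_mul_of_pos_left _ hn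
  exact ⟨⟨⟨μ.sum, Nat.lt_succ_of_le h₂⟩, ⟨μ, fun {i} hi => hμ i hi, rfl⟩⟩, rfl⟩

/-- Primc partitions are pairs of a Capparelli partition and a multiset of sizes. -/
theorem genSeries_primc_eq_mul (hδ : Condition1 δ) (hγ : Condition2 γ) (hn : 0 < n) :
    genSeries {L | IsPrimc n L} (dilatedWeight n) =
      genSeries {L | IsCapparelli n δ γ L} (dilatedWeight n) *
        genSeries positiveMultisets fun μ => ((n * μ.sum : ℕ) : ℤ) := by
  have hadm : ∀ L : List ColouredPart, L ∈ {L | IsCapparelli n δ γ L} → ∀ x ∈ L, Admissible n x :=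
    fun L hL => (isPrimc_iff.1 (show IsCapparelli n δ γ L from hL).primc).1
  rw [← genSeries_prod (fun L hL => dilatedWeight_nonneg (hadm L hL))
    (fun μ _ => Int.natCast_nonneg _) (finiteFibres_of_admissible hadm)
    (finiteFibres_positiveMultisets hn),
    genSeries_bijOn (insertFree δ γ) 0 (S := {L | IsCapparelli n δ γ L} ×ˢ positiveMultisets)
      (v := fun x => dilatedWeight n x.1 + ((n * x.2.sum : ℕ) : ℤ)), pow_zero, one_mul]
  · refine ⟨?_, injOn_insertFree hδ hγ hn, surjOn_insertFree hδ hγ hn⟩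
    rintro ⟨L, μ⟩ ⟨hL, hμ⟩
    exact isPrimc_insertFree hδ hγ hn (show IsCapparelli n δ γ L from hL).primc hμ
  · rintro ⟨L, μ⟩ ⟨hL, -⟩
    rw [dilatedWeight_insertFree hδ hγ hn (show IsCapparelli n δ γ L from hL).primc]
    simp
  · rintro ⟨L, μ⟩ ⟨hL, -⟩
    have := dilatedWeight_nonneg (hadm L hL)
    simp only
    positivity

end Insertion

/-! ### `n`-regular partitions and their product formula. -/

section Regular

/-- Multisets of positive integers not divisible by `n`. -/
def regularMultisets (n : ℕ) : Set (Multiset ℕ) := {μ | ∀ r ∈ μ, 0 < r ∧ ¬ n ∣ r}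

theorem finiteFibres_sum_positiveMultisets :
    FiniteFibres positiveMultisets fun μ => ((μ.sum : ℕ) : ℤ) := by
  simpa using finiteFibres_positiveMultisets one_pos

theorem genSeries_regularMultisets (n : ℕ) :
    genSeries (regularMultisets n) (fun μ => ((μ.sum : ℕ) : ℤ)) =
      PowerSeries.mk fun N => ((Nat.Partition.restricted N (fun k => ¬ n ∣ k)).card : ℚ) := by
  ext N
  rw [coeff_genSeries, PowerSeries.coeff_mk]
  congr 1
  have h : {μ ∈ regularMultisets n | ((μ.sum : ℕ) : ℤ) = N} =
      Nat.Partition.parts '' (Nat.Partition.restricted N (fun k => ¬ n ∣ k) : Set N.Partition) := by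
    ext μ
    simp only [regularMultisets, Set.mem_ofPred_eq, Set.mem_image, Finset.mem_coe,
      Nat.Partition.restricted, Finset.mem_filter, Finset.mem_univ, true_and]
    constructor
    · rintro ⟨h₁, h₂⟩
      exact ⟨⟨μ, fun {i} hi => (h₁ i hi).1, by exact_mod_cast h₂⟩, fun i hi => (h₁ i hi).2, rfl⟩
    · rintro ⟨p, hp, rfl⟩
      exact ⟨fun r hr => ⟨p.parts_pos hr, hp r hr⟩, by exact_mod_cast p.parts_sum⟩
  rw [h, Set.ncard_image_of_injective _ fun p q => Nat.Partition.ext, Set.ncard_coe_finset]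

/-- The inverse separates the multiples of `n` and divides them by `n`. -/
theorem bijOn_add_map_mul {n : ℕ} (hn : 0 < n) :
    Set.BijOn (fun x : Multiset ℕ × Multiset ℕ => x.1 + x.2.map (n * ·))
      (regularMultisets n ×ˢ positiveMultisets) positiveMultisets := by
  have hinj : Function.Injective (n * ·) := fun _ _ h => Nat.eq_of_mul_eq_mul_left hn h
  have hfilter : ∀ ρ ∈ regularMultisets n, ∀ μ : Multiset ℕ,
      (ρ + μ.map (n * ·)).filter (n ∣ ·) = μ.map (n * ·) ∧
        (ρ + μ.map (n * ·)).filter (¬ n ∣ ·) = ρ := by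
    intro ρ hρ μ
    have h₁ : ∀ r ∈ μ.map (n * ·), n ∣ r := by
      intro r hr
      obtain ⟨s, -, rfl⟩ := Multiset.mem_map.1 hr
      exact dvd_mul_right n s
    rw [Multiset.filter_add, Multiset.filter_add, Multiset.filter_eq_self.2 h₁,
      Multiset.filter_eq_nil.2 fun r hr => (hρ r hr).2,
      Multiset.filter_eq_self.2 fun r hr => (hρ r hr).2,
      Multiset.filter_eq_nil.2 fun r hr => not_not.2 (h₁ r hr), zero_add, add_zero]
    exact ⟨rfl, rfl⟩
  refine ⟨?_, ?_, ?_⟩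
  · rintro ⟨ρ, μ⟩ ⟨hρ, hμ⟩ r hr
    rcases Multiset.mem_add.1 hr with hr | hr
    · exact (hρ r hr).1
    · obtain ⟨s, hs, rfl⟩ := Multiset.mem_map.1 hr
      exact Nat.mul_pos hn (hμ s hs)
  · rintro ⟨ρ, μ⟩ ⟨hρ, -⟩ ⟨ρ', μ'⟩ ⟨hρ', -⟩ h
    simp only at h hρ hρ'
    obtain ⟨h₁, h₂⟩ := hfilter ρ hρ μ
    obtain ⟨h₃, h₄⟩ := hfilter ρ' hρ' μ'
    rw [h] at h₁ h₂
    rw [Prod.mk.injEq]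
    exact ⟨h₂.symm.trans h₄, Multiset.map_injective hinj (h₁.symm.trans h₃)⟩
  · intro σ hσ
    refine ⟨(σ.filter (¬ n ∣ ·), (σ.filter (n ∣ ·)).map (· / n)), ⟨?_, ?_⟩, ?_⟩
    · intro r hr
      obtain ⟨h₁, h₂⟩ := Multiset.mem_filter.1 hr
      exact ⟨hσ r h₁, h₂⟩
    · intro r hr
      obtain ⟨s, hs, rfl⟩ := Multiset.mem_map.1 hr
      obtain ⟨h₁, h₂⟩ := Multiset.mem_filter.1 hs
      exact Nat.div_pos (Nat.le_of_dvd (hσ s h₁) h₂) hn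
    · have hmap : ((σ.filter (n ∣ ·)).map (· / n)).map (n * ·) = σ.filter (n ∣ ·) := by
        rw [Multiset.map_map]
        exact (Multiset.map_congr rfl fun s hs =>
          Nat.mul_div_cancel' (Multiset.mem_filter.1 hs).2).trans (Multiset.map_id' _)
      simp only [hmap]
      rw [add_comm]
      exact Multiset.filter_add_not _ σ

theorem genSeries_positiveMultisets_eq_mul {n : ℕ} (hn : 0 < n) :
    genSeries positiveMultisets (fun μ => ((μ.sum : ℕ) : ℤ)) =
      genSeries (regularMultisets n) (fun μ => ((μ.sum : ℕ) : ℤ)) *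
        genSeries positiveMultisets fun μ => ((n * μ.sum : ℕ) : ℤ) := by
  rw [← genSeries_prod (fun _ _ => Int.natCast_nonneg _) (fun _ _ => Int.natCast_nonneg _)
    (finiteFibres_sum_positiveMultisets.mono fun μ hμ r hr => (hμ r hr).1)
    (finiteFibres_positiveMultisets hn),
    genSeries_bijOn _ 0 (v := fun x : Multiset ℕ × Multiset ℕ =>
      ((x.1.sum : ℕ) : ℤ) + ((n * x.2.sum : ℕ) : ℤ)) (bijOn_add_map_mul hn), pow_zero, one_mul]
  · rintro ⟨ρ, μ⟩ -
    simp [Multiset.sum_map_mul_left]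
  · intro x _
    positivity

theorem genSeries_positiveMultisets_ne_zero {n : ℕ} (hn : 0 < n) :
    genSeries positiveMultisets (fun μ => ((n * μ.sum : ℕ) : ℤ)) ≠ 0 := by
  intro h
  have h₀ := congrArg (PowerSeries.coeff 0) h
  rw [coeff_genSeries, map_zero, Nat.cast_eq_zero,
    Set.ncard_eq_zero (finiteFibres_positiveMultisets hn 0)] at h₀
  have : (0 : Multiset ℕ) ∈ {μ ∈ positiveMultisets | ((n * μ.sum : ℕ) : ℤ) = (0 : ℕ)} :=
    ⟨fun r hr => absurd hr (Multiset.notMem_zero r), by simp⟩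
  rw [h₀] at this
  exact this

/-- The generating function of `n`-regular partitions times `(q; q)_∞` is `(q^n; q^n)_∞`. -/
theorem mk_card_restricted_mul {n : ℕ} (hn : 0 < n) :
    (PowerSeries.mk fun N => ((Nat.Partition.restricted N (fun k => ¬ n ∣ k)).card : ℚ)) *
        qPochhammerInf PowerSeries.X PowerSeries.X =
      qPochhammerInf (PowerSeries.X ^ n) (PowerSeries.X ^ n) := by
  have h₁ : qPochhammerInf PowerSeries.X PowerSeries.X =
      ∏' i : ℕ, (1 - (PowerSeries.X : ℚ⟦X⟧) ^ (i + 1)) :=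
    tprod_congr fun i => by rw [pow_succ']
  have h₂ : qPochhammerInf (PowerSeries.X ^ n) (PowerSeries.X ^ n) =
      ∏' i : ℕ, (1 - (PowerSeries.X : ℚ⟦X⟧) ^ ((i + 1) * n)) :=
    tprod_congr fun i => by rw [← pow_succ', ← pow_mul, mul_comm]
  rw [h₁, h₂, Nat.Partition.powerSeriesMk_card_restricted_eq_tprod ℚ (¬ n ∣ ·),
    ← (Nat.Partition.multipliable_powerSeriesMk_card_restricted ℚ (¬ n ∣ ·)).tprod_mul
      (PowerSeries.WithPiTopology.multipliable_one_sub_X_pow _)]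
  simp_rw [ite_not, ite_mul, pow_mul]
  conv in fun b ↦ _ =>
    ext b
    rw [PowerSeries.WithPiTopology.tsum_pow_mul_one_sub_of_constantCoeff_eq_zero (by simp)]
  -- The factors with `n` not dividing `k + 1` have become `1`; the remaining ones are indexed by `k
  -- + 1 = (i + 1) * n`.
  refine tprod_eq_tprod_of_ne_one_bij (fun i ↦ (i.val + 1) * n - 1) ?_ ?_ ?_
  · intro a b h
    rw [tsub_left_inj (by nlinarith) (by nlinarith), mul_left_inj' hn.ne', add_left_inj] at h
    exact SetCoe.ext h
  · suffices ∀ (i : ℕ), n ∣ i + 1 → ∃ j ≠ 0, j * n - 1 = i by simpa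
    intro i hi
    obtain ⟨j, hj⟩ := dvd_def.mp hi
    refine ⟨j, by grind, Nat.sub_eq_of_eq_add ?_⟩
    rw [hj, mul_comm n j]
  · intro i
    have : (i + 1) * n - 1 + 1 = (i + 1) * n := by grind
    simp [this, pow_mul]

theorem qPochhammerInf_X_ne_zero : qPochhammerInf (PowerSeries.X : ℚ⟦X⟧) PowerSeries.X ≠ 0 := by
  have h : qPochhammerInf PowerSeries.X PowerSeries.X =
      ∏' i : ℕ, (1 - (PowerSeries.X : ℚ⟦X⟧) ^ (i + 1)) :=
    tprod_congr fun i => by rw [pow_succ']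
  rw [h]
  exact PowerSeries.WithPiTopology.tprod_one_sub_X_pow_ne_zero ℚ

end Regular

/-! ### Assembly for Capparelli partitions. -/

section Capparelli

variable {n : ℕ} {δ : Colour → ℤ} {γ : Colour → Colour → ℤ}

theorem IsCapparelli.admissible {L : List ColouredPart} (hL : IsCapparelli n δ γ L) :
    ∀ x ∈ L, Admissible n x :=
  (isPrimc_iff.1 hL.primc).1

theorem isCapparelli_nil : IsCapparelli n δ γ [] := by
  have h : IsPrimc n [] := ⟨by simp, by simp, List.isChain_nil⟩
  constructor <;> first | exact h | simp

theorem setOf_isCapparelli_one : {L | IsCapparelli 1 δ γ L} = {[]} := by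
  ext L
  rw [Set.mem_ofPred_eq, Set.mem_singleton_iff]
  constructor
  · intro hL
    rw [List.eq_nil_iff_forall_not_mem]
    intro x hx
    obtain ⟨-, ha, hb⟩ := hL.admissible x hx
    refine hL.no_zero x hx ?_
    rcases x with ⟨p, a, b⟩
    simp only at ha hb
    rw [Nat.lt_one_iff.1 ha, Nat.lt_one_iff.1 hb]
  · rintro rfl
    exact isCapparelli_nil

theorem genSeries_primc_one (hδ : Condition1 δ) (hγ : Condition2 γ) :
    genSeries {L | IsPrimc 1 L} (dilatedWeight 1) =
      genSeries positiveMultisets fun μ => ((μ.sum : ℕ) : ℤ) := by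
  rw [genSeries_primc_eq_mul hδ hγ one_pos, setOf_isCapparelli_one, genSeries_nil, one_mul]
  simp only [one_mul]

/-- Let `E(q)` and `R_n` count all partitions and the `n`-regular ones. Then `C_n * E(q^n) = P_n =
P_1 = E(q) = R_n * E(q^n)`, and `E(q^n)` cancels. -/
theorem genSeries_capparelli (hδ : Condition1 δ) (hγ : Condition2 γ) (hn : 0 < n) :
    genSeries {L | IsCapparelli n δ γ L} (dilatedWeight n) =
      PowerSeries.mk fun N => ((Nat.Partition.restricted N (fun k => ¬ n ∣ k)).card : ℚ) := by
  refine mul_right_cancel₀ (genSeries_positiveMultisets_ne_zero hn) ?_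
  rw [← genSeries_regularMultisets, ← genSeries_positiveMultisets_eq_mul hn,
    ← genSeries_primc_eq_mul hδ hγ hn, genSeries_primc_eq hn, genSeries_primc_one hδ hγ]

theorem finiteFibres_capparelli : FiniteFibres {L | IsCapparelli n δ γ L} (dilatedWeight n) :=
  finiteFibres_of_admissible fun _ hL => IsCapparelli.admissible hL

theorem finite_capparelliSet (m : ℕ) (u v : Fin n → ℕ) : (capparelliSet n δ γ m u v).Finite := by
  refine (finite_admissible_lists n m m).subset ?_
  rintro L ⟨hL, hm, -, -⟩
  refine ⟨fun x hx => ⟨hL.admissible x hx, ?_⟩, ?_⟩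
  · rw [← hm]
    exact List.le_sum_of_mem (List.mem_map_of_mem hx)
  · rw [← hm, ← List.length_map (f := ColouredPart.size)]
    refine List.length_le_sum_of_one_le _ fun p hp => ?_
    obtain ⟨x, hx, rfl⟩ := List.mem_map.1 hp
    exact (hL.admissible x hx).1

theorem sum_map_eq_sum_countP {α : Type*} (f : α → ℕ) {L : List α} (h : ∀ x ∈ L, f x < n) :
    (L.map f).sum = ∑ i : Fin n, (i : ℕ) * L.countP fun x => f x = (i : ℕ) := by
  induction L with
  | nil => simp
  | cons x L ih =>
    rw [List.map_cons, List.sum_cons, ih fun y hy => h y (List.mem_cons_of_mem _ hy)]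
    simp only [List.countP_cons, mul_add, Finset.sum_add_distrib, decide_eq_true_eq, mul_ite,
      mul_one, mul_zero]
    rw [add_comm]
    congr 1
    rw [Finset.sum_eq_single ⟨f x, h x List.mem_cons_self⟩]
    · simp
    · intro i _ hi
      exact if_neg fun h' => hi (Fin.ext h'.symm)
    · simp

theorem dilatedWeight_eq {L : List ColouredPart} (h : ∀ x ∈ L, Admissible n x) :
    dilatedWeight n L = (n : ℤ) * (L.map ColouredPart.size).sum -
      ∑ i : Fin n, (i : ℤ) * (((L.countP fun x => x.colour.a = (i : ℕ) : ℕ) : ℤ) -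
        ((L.countP fun x => x.colour.b = (i : ℕ) : ℕ) : ℤ)) := by
  have h₁ : dilatedWeight n L = (n : ℤ) * (L.map ColouredPart.size).sum -
      (((L.map fun x => x.colour.a).sum : ℕ) : ℤ) + (((L.map fun x => x.colour.b).sum : ℕ) : ℤ) := by
    clear h
    induction L with
    | nil => simp [dilatedWeight_nil]
    | cons x L ih =>
      rw [dilatedWeight_cons, ih]
      simp only [List.map_cons, List.sum_cons]
      push_cast
      ring
  rw [h₁, sum_map_eq_sum_countP _ fun x hx => (h x hx).2.1,
    sum_map_eq_sum_countP _ fun x hx => (h x hx).2.2]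
  push_cast
  simp only [mul_sub, Finset.sum_sub_distrib]
  ring

end Capparelli

/-- Collecting the elements of `S` by a statistic `g` that determines their weight gives a
summable family of monomials, with sum the generating function of `S`. -/
theorem exists_summableFamily_genSeries {α ι : Type*} {S : Set α} {w : α → ℤ}
    (hS : FiniteFibres S w) (hw : ∀ x ∈ S, 0 ≤ w x) (g : α → ι) (k : ι → ℤ)
    (hk : ∀ x ∈ S, w x = k (g x)) :
    ∃ F : HahnSeries.SummableFamily ℤ ℚ ι,
      (∀ i, F i = HahnSeries.single (k i) ({x ∈ S | g x = i}.ncard : ℚ)) ∧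
      F.hsum = ((genSeries S w : ℚ⟦X⟧) : ℚ⸨X⸩) := by
  classical
  have key : ∀ i e, (HahnSeries.single (k i) ({x ∈ S | g x = i}.ncard : ℚ)).coeff e ≠ 0 →
      ∃ x ∈ S, g x = i ∧ w x = e := by
    intro i e h
    rw [HahnSeries.coeff_single] at h
    have he : e = k i := by
      by_contra he
      exact h (if_neg he)
    rw [if_pos he] at h
    obtain ⟨x, hx, hxi⟩ := Set.nonempty_of_ncard_ne_zero (Nat.cast_ne_zero.1 h)
    exact ⟨x, hx, hxi, by rw [hk x hx, hxi, he]⟩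
  -- The exponent `k i` may be negative, but then no element of `S` has statistic `i` and the
  -- monomial vanishes.
  have hneg : ∀ i e, e < 0 →
      (HahnSeries.single (k i) ({x ∈ S | g x = i}.ncard : ℚ)).coeff e = 0 := by
    intro i e he
    by_contra h
    obtain ⟨x, hx, -, rfl⟩ := key i e h
    exact absurd (hw x hx) (not_le.2 he)
  let F : HahnSeries.SummableFamily ℤ ℚ ι :=
    { toFun := fun i => HahnSeries.single (k i) ({x ∈ S | g x = i}.ncard : ℚ)
      isPWO_iUnion_support' := by
        refine (bddBelow_Ici (a := (0 : ℤ))).isWF.isPWO.mono ?_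
        intro e he
        obtain ⟨i, hi⟩ := Set.mem_iUnion.1 he
        by_contra h
        exact hi (hneg i e (not_le.1 h))
      finite_co_support' := fun e => by
        rcases lt_or_ge e 0 with he | he
        · simp [hneg _ e he]
        · obtain ⟨e, rfl⟩ := Int.eq_ofNat_of_zero_le he
          refine ((hS e).image g).subset fun i hi => ?_
          obtain ⟨x, hx, hxi, hxe⟩ := key i e hi
          exact ⟨x, ⟨hx, hxe⟩, hxi⟩ }
  have hF : ∀ i, F i = HahnSeries.single (k i) ({x ∈ S | g x = i}.ncard : ℚ) := fun i => rfl
  refine ⟨F, hF, ?_⟩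
  ext e
  rcases lt_or_ge e 0 with he | he
  · rw [HahnSeries.SummableFamily.coeff_hsum, PowerSeries.coeff_coe, if_pos he]
    simp only [hF, hneg _ e he, finsum_zero]
  obtain ⟨e, rfl⟩ := Int.eq_ofNat_of_zero_le he
  rw [PowerSeries.coeff_coe, if_neg (not_lt.2 he), Int.natAbs_natCast, coeff_genSeries,
    HahnSeries.SummableFamily.coeff_hsum_eq_sum_of_subset (t := (hS e).toFinset.image g),
    Set.ncard_eq_toFinset_card _ (hS e), Finset.card_eq_sum_card_image g]
  · push_cast
    refine Finset.sum_congr rfl fun i hi => ?_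
    obtain ⟨y, hy, rfl⟩ := Finset.mem_image.1 hi
    obtain ⟨hyS, hye⟩ := (hS e).mem_toFinset.1 hy
    rw [hF, HahnSeries.coeff_single, if_pos (by rw [← hk y hyS, hye]), ← Set.ncard_coe_finset]
    congr 2
    ext x
    simp only [Set.mem_ofPred_eq, Finset.coe_filter, Set.Finite.mem_toFinset]
    constructor
    · rintro ⟨hx, hxy⟩
      exact ⟨⟨hx, by rw [hk x hx, hxy, ← hk y hyS, hye]⟩, hxy⟩
    · rintro ⟨⟨hx, -⟩, hxy⟩
      exact ⟨hx, hxy⟩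
  · intro i hi
    obtain ⟨x, hx, hxi, hxe⟩ := key i e hi
    rw [Finset.mem_coe, Finset.mem_image]
    exact ⟨x, (hS e).mem_toFinset.2 ⟨hx, hxe⟩, hxi⟩

theorem mainTheorem7 (n : ℕ) (hn : 0 < n) (δ : Colour → ℤ) (γ : Colour → Colour → ℤ)
    (hδ : Condition1 δ) (hγ : Condition2 γ) :
    -- the numbers `C_n(δ, γ; m; u; v)` are finite
    (∀ (m : ℕ) (u v : Fin n → ℕ), (capparelliSet n δ γ m u v).Finite) ∧
    -- the specialised generating function is a well-defined formal series, with the stated value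
    (∃ S : HahnSeries.SummableFamily ℤ ℚ (ℕ × (Fin n → ℕ) × (Fin n → ℕ)),
      (∀ (m : ℕ) (u v : Fin n → ℕ), S (m, u, v) =
        HahnSeries.single ((n : ℤ) * m - ∑ i : Fin n, (i : ℤ) * ((u i : ℤ) - (v i : ℤ)))
          (capparelliCount n δ γ m u v : ℚ)) ∧
      S.hsum =
        ((qPochhammerInf (PowerSeries.X ^ n) (PowerSeries.X ^ n) : ℚ⟦X⟧) : ℚ⸨X⸩) /
          ((qPochhammerInf PowerSeries.X PowerSeries.X : ℚ⟦X⟧) : ℚ⸨X⸩)) ∧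
    -- equinumerosity with `n`-regular partitions after the dilation
    (∀ N : ℕ, {L : List ColouredPart | IsCapparelli n δ γ L ∧ dilatedWeight n L = N}.encard =
      ((Nat.Partition.restricted N (fun k => ¬ n ∣ k)).card : ℕ∞)) := by
  refine ⟨finite_capparelliSet, ?_, fun N => ?_⟩
  · obtain ⟨F, hF, hsum⟩ := exists_summableFamily_genSeries
      (finiteFibres_capparelli (n := n) (δ := δ) (γ := γ))
      (fun L hL => dilatedWeight_nonneg (IsCapparelli.admissible hL))
      (fun L => ((L.map ColouredPart.size).sum,
        (fun i : Fin n => L.countP fun x => x.colour.a = (i : ℕ)),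
        (fun i : Fin n => L.countP fun x => x.colour.b = (i : ℕ))))
      (fun x => (n : ℤ) * x.1 - ∑ i : Fin n, (i : ℤ) * ((x.2.1 i : ℤ) - (x.2.2 i : ℤ)))
      (fun L hL => dilatedWeight_eq (IsCapparelli.admissible hL))
    refine ⟨F, fun m u v => ?_, ?_⟩
    · rw [hF, capparelliCount]
      congr 3
      ext L
      simp only [capparelliSet, Set.mem_ofPred_eq, Prod.mk.injEq, funext_iff]
    · have hne : ((qPochhammerInf PowerSeries.X PowerSeries.X : ℚ⟦X⟧) : ℚ⸨X⸩) ≠ 0 := by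
        rw [Ne, map_eq_zero_iff _ HahnSeries.ofPowerSeries_injective]
        exact qPochhammerInf_X_ne_zero
      rw [hsum, eq_div_iff hne, genSeries_capparelli hδ hγ hn, ← map_mul,
        mk_card_restricted_mul hn]
  · have h := congrArg (PowerSeries.coeff N) (genSeries_capparelli hδ hγ hn)
    rw [coeff_genSeries, PowerSeries.coeff_mk, Nat.cast_inj] at h
    rw [← h]
    exact (Set.Finite.cast_ncard_eq (finiteFibres_capparelli N)).symm
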